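/- Let $\Gamma=(V,E)$ be an infinite, locally finite tree with a distinguished root $\bar 0$ and without vertices of degree $1$. The AKLT model on $\Gamma$ has at each vertex $x$ a spin $\deg(x)/2$, with Hilbert space $\mathcal H_x=\mathbb C^{\deg(x)+1}$. For $n\ge 0$ let $T_n$ be the subtree induced on the vertices at distance at most $n$ from $\bar 0$, and let $$H_n=\sum_{\{x,y\}\in E(T_n)}P_{xy}$$ on $\bigotimes_{x\in T_n}\mathcal H_x$, where $P_{xy}$ is the orthogonal projection onto the subspace in which the spins at $x$ and $y$ have the maximal total spin $(\deg(x)+\deg(y))/2$; the degrees are those in $\Gamma$, so the vertices at distance $n$ keep their full spin. A finite-volume ground state on $T_n$ is a state given by a density matrix $\rho_n$ with $H_n\rho_n=0$ (equivalently, one obtained from a boundary condition on the edges that leave $T_n$). An infinite-volume ground state is a functional $\omega$ on the local observables such that $\omega(A)=\lim_{n\to\infty}\mathrm{Tr}(\rho_n A)$ for all local observables $A$, for some sequence of finite-volume ground states $\rho_n$ on $T_n$. Suppose there are $\mu>1$ and $C>0$ such that for every infinite path $\bar 0=x_0,x_1,x_2,\dots$ in $\Gamma$ with $|x_k-\bar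 0|=k$ for all $k$, and for every $n\ge 0$, $$\prod_{k=1}^n\frac{\deg(x_k)-1}{3}\ \ge\ C\mu^n .$$ Then the AKLT ground state on $\Gamma$ is not unique: there are two different infinite-volume ground states. -/

import Mathlib

open Filter Topology
open scoped ComplexOrder

noncomputable section

namespace AKLT

/-! ### Spin operators

A site carrying the spin `s = d / 2` has the Hilbert space `ℂ ^ (d + 1)`; the basis vector number `j`
is the normalized eigenvector of `S^z` with eigenvalue `j - d / 2`. -/

/-- `S^z` in the spin `d / 2` representation of `su(2)`. -/
def spinZ (d : ℕ) : Matrix (Fin (d + 1)) (Fin (d + 1)) ℂ :=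
  Matrix.diagonal fun j => ((j : ℕ) : ℂ) - (d : ℂ) / 2

/-- The raising operator `S^+ = S^x + i S^y` in the spin `d / 2` representation:
`S^+ |j⟩ = √((j + 1) (d - j)) |j + 1⟩`. -/
def spinRaise (d : ℕ) : Matrix (Fin (d + 1)) (Fin (d + 1)) ℂ :=
  Matrix.of fun i j =>
    if (i : ℕ) = (j : ℕ) + 1 then
      ((Real.sqrt ((((j : ℕ) : ℝ) + 1) * ((d : ℝ) - ((j : ℕ) : ℝ))) : ℝ) : ℂ)
    else 0

/-- `S^x` in the spin `d / 2` representation. -/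
def spinX (d : ℕ) : Matrix (Fin (d + 1)) (Fin (d + 1)) ℂ :=
  (1 / 2 : ℂ) • (spinRaise d + (spinRaise d).conjTranspose)

/-- `S^y` in the spin `d / 2` representation. -/
def spinY (d : ℕ) : Matrix (Fin (d + 1)) (Fin (d + 1)) ℂ :=
  (1 / (2 * Complex.I) : ℂ) • (spinRaise d - (spinRaise d).conjTranspose)

/-! ### Finite regions

`d x` is twice the spin at the site `x`. -/

/-- The labels of the product basis of `⨂_{x ∈ Λ} ℂ ^ (d x + 1)`. -/
abbrev Conf {V : Type*} (d : V → ℕ) (Λ : Finset V) : Type _ :=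
  (x : Λ) → Fin (d x + 1)

/-- Operators on `⨂_{x ∈ Λ} ℂ ^ (d x + 1)`, that is, the observables supported in `Λ`. -/
abbrev Obs {V : Type*} (d : V → ℕ) (Λ : Finset V) : Type _ :=
  Matrix (Conf d Λ) (Conf d Λ) ℂ

/-- The operator `M ⊗ 1` with `M` acting on the site `x` and the identity on the other sites. -/
def onSite {V : Type*} [DecidableEq V] {d : V → ℕ} {Λ : Finset V} (x : Λ)
    (M : Matrix (Fin (d x + 1)) (Fin (d x + 1)) ℂ) : Obs d Λ :=
  Matrix.of fun σ τ => if ∀ y : Λ, y ≠ x → σ y = τ y then M (σ x) (τ x) else 0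

/-- The operator `A ⊗ 1` on the region `Λ'` for `A` supported in `Λ ⊆ Λ'`. -/
def extend {V : Type*} [DecidableEq V] {d : V → ℕ} {Λ Λ' : Finset V} (h : Λ ⊆ Λ')
    (A : Obs d Λ) : Obs d Λ' :=
  Matrix.of fun σ τ =>
    if ∀ y : Λ', (y : V) ∉ Λ → σ y = τ y then
      A (fun x => σ ⟨x, h x.2⟩) (fun x => τ ⟨x, h x.2⟩)
    else 0

/-- The Casimir operator `∑_{α = x, y, z} (S_x^α + S_y^α)²` of the total spin of the sites
`x` and `y`. -/
def pairCasimir {V : Type*} [DecidableEq V] (d : V → ℕ) (Λ : Finset V) (x y : Λ) : Obs d Λ :=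
  (onSite x (spinX (d x)) + onSite y (spinX (d y))) ^ 2
    + (onSite x (spinY (d x)) + onSite y (spinY (d y))) ^ 2
    + (onSite x (spinZ (d x)) + onSite y (spinZ (d y))) ^ 2

/-- The subspace of the vectors for which the sites `x` and `y` have the maximal total spin
`J = (d x + d y) / 2`: the eigenspace of the Casimir operator for `J (J + 1)`. -/
def maxSpinSpace {V : Type*} [DecidableEq V] (d : V → ℕ) (Λ : Finset V) (x y : Λ) :
    Submodule ℂ (EuclideanSpace ℂ (Conf d Λ)) :=
  Module.End.eigenspace (Matrix.toEuclideanLin (pairCasimir d Λ x y))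
    ((((d x : ℂ) + (d y : ℂ)) / 2) * (((d x : ℂ) + (d y : ℂ)) / 2 + 1))

/-- The AKLT Hamiltonian of the region `Λ`: each edge of `G` with both ends in `Λ` contributes the
orthogonal projection onto the maximal total spin of its two ends, where the site `x` carries the
spin `deg x / 2` (the degree being that in the whole graph `G`). The double sum runs over ordered
pairs and meets each edge twice, whence the factor `1 / 2`. -/
def hamiltonian {V : Type*} [DecidableEq V] (G : SimpleGraph V) [G.LocallyFinite]
    [DecidableRel G.Adj] (Λ : Finset V) :
    EuclideanSpace ℂ (Conf (fun v => G.degree v) Λ) →L[ℂ]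
      EuclideanSpace ℂ (Conf (fun v => G.degree v) Λ) :=
  (1 / 2 : ℂ) • ∑ x : Λ, ∑ y : Λ,
    if G.Adj x y then (maxSpinSpace (fun v => G.degree v) Λ x y).starProjection else 0

/-- `ρ` is the density matrix of a (pure or mixed) ground state of the region `Λ`: a positive
semidefinite matrix of trace one whose range lies in the kernel of the Hamiltonian. -/
structure IsGroundState {V : Type*} [DecidableEq V] (G : SimpleGraph V) [G.LocallyFinite]
    [DecidableRel G.Adj] (Λ : Finset V) (ρ : Obs (fun v => G.degree v) Λ) : Prop where
  posSemidef : ρ.PosSemidef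
  trace_eq_one : ρ.trace = 1
  hamiltonian_eq_zero : ∀ ψ, hamiltonian G Λ (Matrix.toEuclideanLin ρ ψ) = 0

/-! ### The infinite volume -/

/-- The set of the vertices at distance at most `n` from the root `o`. -/
def ball {V : Type*} [DecidableEq V] (G : SimpleGraph V) [G.LocallyFinite] (o : V) :
    ℕ → Finset V
  | 0 => {o}
  | n + 1 => ball G o n ∪ (ball G o n).biUnion fun v => G.neighborFinset v

theorem mem_ball {V : Type*} [DecidableEq V] (G : SimpleGraph V) [G.LocallyFinite]
    (hG : G.Connected) (o x : V) (n : ℕ) : x ∈ ball G o n ↔ G.dist o x ≤ n := by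
  induction n generalizing x with
  | zero => simp [ball, hG.dist_eq_zero_iff, eq_comm]
  | succ n ih =>
    simp only [ball, Finset.mem_union, Finset.mem_biUnion, SimpleGraph.mem_neighborFinset, ih]
    constructor
    · rintro (h | ⟨y, hy, hyx⟩)
      · omega
      · have h1 := hG.dist_triangle (u := o) (v := y) (w := x)
        have h2 : G.dist y x = 1 := SimpleGraph.dist_eq_one_iff_adj.2 hyx
        omega
    · intro h
      by_cases hn : G.dist o x ≤ n
      · exact Or.inl hn
      · right
        obtain ⟨p, hp⟩ := hG.exists_walk_length_eq_dist x o
        cases p with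
        | nil => simp at hn
        | cons hadj q =>
          refine ⟨_, ?_, hadj.symm⟩
          have h1 := SimpleGraph.dist_le q
          rw [SimpleGraph.Walk.length_cons, SimpleGraph.dist_comm] at hp
          rw [SimpleGraph.dist_comm] at h1
          omega

/-- The expectation `Tr (ρ (A ⊗ 1))` of the observable `A` supported in `Λ` in the state on the
region `Λ'` with density matrix `ρ`; by convention `0` unless `Λ ⊆ Λ'`. -/
def expectation {V : Type*} [DecidableEq V] {d : V → ℕ} {Λ' : Finset V} (ρ : Obs d Λ')
    (Λ : Finset V) (A : Obs d Λ) : ℂ :=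
  if h : Λ ⊆ Λ' then (ρ * extend h A).trace else 0

/-- The infinite-volume ground states of the AKLT model on `G`: the functionals `ω` on the local
observables that are weak limits, as `n → ∞`, of ground states of the balls of radius `n` around
the root `o`. -/
def infiniteVolumeGroundStates {V : Type*} [DecidableEq V] (G : SimpleGraph V) [G.LocallyFinite]
    [DecidableRel G.Adj] (o : V) :
    Set ((Λ : Finset V) → Obs (fun v => G.degree v) Λ → ℂ) :=
  {ω | ∃ ρ : (n : ℕ) → Obs (fun v => G.degree v) (ball G o n),
    (∀ n, IsGroundState G (ball G o n) (ρ n)) ∧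
    ∀ (Λ : Finset V) (A : Obs (fun v => G.degree v) Λ),
      Tendsto (fun n => expectation (ρ n) Λ A) atTop (𝓝 (ω Λ A))}

end AKLT

end

/-! In a valence bond state on the ball `B` each edge carries one of the two terms of its singlet
bond. With a boundary all of whose outgoing edges are marked alike, the squared amplitude of a set
of marked edges is a product over the vertices of the Beta integrals `∫ t ^ k (1 - t) ^ (d - k)`,
`k` being the number of marks at the vertex and `d` its degree. Summing over the marks turns the
norm of the state into an integral over one variable in `[0, 1]` per vertex, with the kernel
`t s + (1 - t) (1 - s)` on each edge. This is computed by integrating from the leaves to the root: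
every branch sends its parent an affine message, a multiple of `1 + β (2 t - 1)` with `0 < β ≤ 1`.

For a vertex with `m` children whose messages have the slopes `β i`, the slope of the message it
sends is at least about `β m / 3`, as long as this is small, so the growth condition is what keeps
`β` at the root away from `0`, uniformly in `B`. Then so is the magnetization at the root. The
opposite boundary condition reverses its sign, hence the limits of the two families of states along
an ultrafilter differ. -/

noncomputable section

namespace AKLT

open scoped Matrix Finset

/-! ### Schwinger bosons -/

section OneSite

/-- The matrix with the entries `a 0, a 1, …` directly below the diagonal. -/
def lowerShift (d : ℕ) (a : ℕ → ℝ) : Matrix (Fin (d + 1)) (Fin (d + 1)) ℂ :=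
  Matrix.of fun i j => if (i : ℕ) = (j : ℕ) + 1 then ((a j : ℝ) : ℂ) else 0

theorem lowerShift_mul_conjTranspose (d : ℕ) (a b : ℕ → ℝ) :
    lowerShift d a * (lowerShift d b)ᴴ = Matrix.diagonal fun i : Fin (d + 1) =>
      if (i : ℕ) = 0 then 0 else ((a ((i : ℕ) - 1) * b ((i : ℕ) - 1) : ℝ) : ℂ) := by
  ext i k
  simp only [Matrix.mul_apply, lowerShift, Matrix.conjTranspose_apply, Matrix.of_apply,
    Matrix.diagonal_apply]
  by_cases hi : (i : ℕ) = 0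
  · rw [Finset.sum_eq_zero fun j _ => by rw [if_neg (by omega), zero_mul]]
    simp [hi]
  · rw [Finset.sum_eq_single (⟨i - 1, by omega⟩ : Fin (d + 1))
      (fun j _ hj => by rw [if_neg (fun h => hj (Fin.ext (by simp; omega))), zero_mul])
      (by simp)]
    by_cases hik : i = k
    · subst hik
      have : (i : ℕ) = (i : ℕ) - 1 + 1 := by omega
      simp [hi, ← this]
    · have : ¬ (k : ℕ) = (i : ℕ) - 1 + 1 := fun h => hik (Fin.ext (by omega))
      simp [hik, this]

theorem conjTranspose_mul_lowerShift (d : ℕ) (a b : ℕ → ℝ) :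
    (lowerShift d a)ᴴ * lowerShift d b = Matrix.diagonal fun j : Fin (d + 1) =>
      if (j : ℕ) < d then ((a j * b j : ℝ) : ℂ) else 0 := by
  ext i k
  simp only [Matrix.mul_apply, lowerShift, Matrix.conjTranspose_apply, Matrix.of_apply,
    Matrix.diagonal_apply]
  by_cases hi : (i : ℕ) < d
  · rw [Finset.sum_eq_single (⟨i + 1, by omega⟩ : Fin (d + 1))
      (fun j _ hj => by rw [if_neg (fun h => hj (Fin.ext h)), star_zero, zero_mul]) (by simp)]
    by_cases hik : i = k
    · subst hik
      simp [hi]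
    · have : ¬ (i : ℕ) = (k : ℕ) := fun h => hik (Fin.ext h)
      simp [hik, this]
  · rw [Finset.sum_eq_zero fun j _ => by rw [if_neg (by omega), star_zero, zero_mul]]
    simp [hi]

/-- The creation operator of a boson of the first kind. The spin `d / 2` is represented by `d`
bosons of two kinds, the basis vector number `j` having `j` bosons of the first kind; the operator
raises `j`, the total number of bosons being suppressed. -/
def createFirst (d : ℕ) : Matrix (Fin (d + 1)) (Fin (d + 1)) ℂ :=
  lowerShift d fun j => √((j : ℝ) + 1)

/-- The weight with which a boson of the second kind enters the basis vector number `j`. Together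
with `createFirst` it factorizes the spin operators as the two bosons do. -/
def createSecond (d : ℕ) : Matrix (Fin (d + 1)) (Fin (d + 1)) ℂ :=
  Matrix.diagonal fun j => ((√((d : ℝ) - (j : ℕ)) : ℝ) : ℂ)

theorem spinRaise_eq_lowerShift (d : ℕ) :
    spinRaise d = lowerShift d fun j => √(((j : ℝ) + 1) * ((d : ℝ) - j)) := rfl

theorem createSecond_conjTranspose (d : ℕ) : (createSecond d)ᴴ = createSecond d := by
  rw [createSecond, Matrix.diagonal_conjTranspose]
  congr 1
  ext j
  simp

theorem createFirst_mul_createSecond (d : ℕ) : createFirst d * createSecond d = spinRaise d := by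
  ext i j
  rw [createFirst, createSecond, Matrix.mul_diagonal, spinRaise_eq_lowerShift]
  simp only [lowerShift, Matrix.of_apply]
  split_ifs
  · rw [Real.sqrt_mul (by positivity)]
    push_cast
    ring
  · simp

theorem createSecond_mul_createFirst_conjTranspose (d : ℕ) :
    createSecond d * (createFirst d)ᴴ = (spinRaise d)ᴴ := by
  rw [← createFirst_mul_createSecond, Matrix.conjTranspose_mul, createSecond_conjTranspose]

theorem fin_cast_le (d : ℕ) (j : Fin (d + 1)) : ((j : ℕ) : ℝ) ≤ d :=
  Nat.cast_le.2 (Fin.is_le j)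

theorem createSecond_mul_self (d : ℕ) :
    createSecond d * createSecond d = ((d : ℂ) / 2) • 1 - spinZ d := by
  rw [createSecond, Matrix.diagonal_mul_diagonal, spinZ, Matrix.smul_one_eq_diagonal,
    Matrix.diagonal_sub]
  congr 1
  ext j
  rw [← Complex.ofReal_mul, Real.mul_self_sqrt (by linarith [fin_cast_le d j])]
  push_cast
  ring

theorem createFirst_mul_conjTranspose (d : ℕ) :
    createFirst d * (createFirst d)ᴴ = ((d : ℂ) / 2) • 1 + spinZ d := by
  rw [createFirst, lowerShift_mul_conjTranspose, spinZ, Matrix.smul_one_eq_diagonal,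
    Matrix.diagonal_add]
  congr 1
  ext j
  split_ifs with h
  · simp [h]
  · rw [Real.mul_self_sqrt (by positivity), Nat.cast_sub (by omega)]
    push_cast
    ring

theorem spinRaise_mul_conjTranspose (d : ℕ) :
    spinRaise d * (spinRaise d)ᴴ =
      Matrix.diagonal fun j : Fin (d + 1) => (j : ℂ) * ((d : ℂ) - (j : ℕ) + 1) := by
  rw [spinRaise_eq_lowerShift, lowerShift_mul_conjTranspose]
  congr 1
  ext j
  split_ifs with h
  · simp [h]
  · have hj := fin_cast_le d j
    have hj1 : (1 : ℝ) ≤ (j : ℕ) := by exact_mod_cast Nat.one_le_iff_ne_zero.2 h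
    rw [Nat.cast_sub (by omega), Nat.cast_one,
      Real.mul_self_sqrt (mul_nonneg (by linarith) (by linarith))]
    push_cast
    ring

theorem spinRaise_conjTranspose_mul (d : ℕ) :
    (spinRaise d)ᴴ * spinRaise d =
      Matrix.diagonal fun j : Fin (d + 1) => ((j : ℕ) + 1 : ℂ) * ((d : ℂ) - (j : ℕ)) := by
  rw [spinRaise_eq_lowerShift, conjTranspose_mul_lowerShift]
  congr 1
  ext j
  split_ifs with h
  · have hj := fin_cast_le d j
    rw [Real.mul_self_sqrt (mul_nonneg (by positivity) (by linarith))]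
    push_cast
    ring
  · simp [show (j : ℕ) = d by omega]

theorem spinX_sq_add_spinY_sq (d : ℕ) :
    spinX d ^ 2 + spinY d ^ 2 =
      (1 / 2 : ℂ) • (spinRaise d * (spinRaise d)ᴴ + (spinRaise d)ᴴ * spinRaise d) := by
  have hI : (1 / (2 * Complex.I)) ^ 2 = (-(1 / 4) : ℂ) := by
    rw [div_pow, mul_pow, Complex.I_sq]; norm_num
  rw [spinX, spinY, smul_pow, smul_pow, hI]
  simp only [pow_two, add_mul, mul_add, sub_mul, mul_sub]
  module

theorem spin_casimir (d : ℕ) :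
    spinX d ^ 2 + spinY d ^ 2 + spinZ d ^ 2 = ((d : ℂ) / 2 * ((d : ℂ) / 2 + 1)) • 1 := by
  rw [spinX_sq_add_spinY_sq, spinRaise_mul_conjTranspose, spinRaise_conjTranspose_mul, spinZ,
    Matrix.diagonal_pow, Matrix.smul_one_eq_diagonal, Matrix.diagonal_add, ← Matrix.diagonal_smul,
    Matrix.diagonal_add]
  congr 1
  ext j
  simp only [Pi.smul_apply, Pi.pow_apply, smul_eq_mul]
  ring

end OneSite

/-! ### Valence bonds -/

section Bond

variable {V : Type*} [DecidableEq V] {d : V → ℕ} {Λ : Finset V}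

theorem onSite_mulVec (x : Λ) (M : Matrix (Fin (d x + 1)) (Fin (d x + 1)) ℂ)
    (χ : Conf d Λ → ℂ) (σ : Conf d Λ) :
    (onSite x M *ᵥ χ) σ = ∑ j, M (σ x) j * χ (Function.update σ x j) := by
  simp only [Matrix.mulVec, dotProduct, onSite, Matrix.of_apply]
  symm
  refine Fintype.sum_of_injective (fun j => Function.update σ x j)
    (Function.update_injective σ x) _ _ (fun τ hτ => ?_) fun j => ?_
  · rw [if_neg, zero_mul]
    exact fun h => hτ ⟨τ x, (Function.eq_update_iff.2 ⟨rfl, fun y hy => (h y hy).symm⟩).symm⟩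
  · rw [if_pos fun y hy => (Function.update_of_ne hy _ _).symm, Function.update_self]

/-- `onSite x` as a homomorphism of star algebras. -/
def siteHom (x : Λ) : Matrix (Fin (d x + 1)) (Fin (d x + 1)) ℂ →⋆ₐ[ℂ] Obs d Λ where
  toFun := onSite x
  map_one' := by
    refine Matrix.mulVec_injective (funext₂ fun χ σ => ?_)
    simp [onSite_mulVec, Matrix.one_apply]
  map_mul' M N := by
    refine Matrix.mulVec_injective (funext₂ fun χ σ => ?_)
    simp only [← Matrix.mulVec_mulVec, onSite_mulVec, Function.update_self, Function.update_idem,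
      Matrix.mul_apply, Finset.mul_sum, Finset.sum_mul]
    rw [Finset.sum_comm]
    simp only [mul_assoc]
  map_zero' := by
    ext σ τ
    simp [onSite]
  map_add' M N := by
    ext σ τ
    simp only [onSite, Matrix.of_apply, Matrix.add_apply]
    split_ifs <;> simp
  commutes' r := by
    refine Matrix.mulVec_injective (funext₂ fun χ σ => ?_)
    simp [onSite_mulVec, Algebra.algebraMap_eq_smul_one, Matrix.smul_mulVec, Matrix.one_apply]
  map_star' M := by
    ext σ τ
    simp only [onSite, Matrix.star_apply, Matrix.of_apply, eq_comm (a := σ _)]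
    split_ifs <;> simp

theorem siteHom_apply (x : Λ) (M : Matrix (Fin (d x + 1)) (Fin (d x + 1)) ℂ) :
    siteHom x M = onSite x M := rfl

theorem siteHom_conjTranspose (x : Λ) (M : Matrix (Fin (d x + 1)) (Fin (d x + 1)) ℂ) :
    siteHom x Mᴴ = (siteHom x M)ᴴ := map_star (siteHom x) M

theorem siteHom_commute {x y : Λ} (h : x ≠ y) (M : Matrix (Fin (d x + 1)) (Fin (d x + 1)) ℂ)
    (N : Matrix (Fin (d y + 1)) (Fin (d y + 1)) ℂ) : Commute (siteHom x M) (siteHom y N) := by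
  refine Matrix.mulVec_injective (funext₂ fun χ σ => ?_)
  simp only [siteHom_apply, ← Matrix.mulVec_mulVec, onSite_mulVec, Function.update_of_ne h,
    Function.update_of_ne h.symm, Finset.mul_sum]
  rw [Finset.sum_comm]
  refine Finset.sum_congr rfl fun j _ => Finset.sum_congr rfl fun i _ => ?_
  rw [Function.update_comm h]
  ring

/-- The creation of a valence bond, that is, of a singlet of two bosons, one at `x` and one
at `y`. -/
def bond (d : V → ℕ) (Λ : Finset V) (x y : Λ) : Obs d Λ :=
  siteHom x (createFirst (d x)) * siteHom y (createSecond (d y))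
    - siteHom x (createSecond (d x)) * siteHom y (createFirst (d y))

theorem bond_swap {x y : Λ} (h : x ≠ y) : bond d Λ y x = -bond d Λ x y := by
  rw [bond, bond, (siteHom_commute h _ _).eq, (siteHom_commute h _ _).eq, neg_sub]

theorem pairCasimir_eq {x y : Λ} (h : x ≠ y) :
    pairCasimir d Λ x y =
      ((d x : ℂ) / 2 * ((d x : ℂ) / 2 + 1) + (d y : ℂ) / 2 * ((d y : ℂ) / 2 + 1)) • 1
      + (siteHom x (spinRaise (d x)) * siteHom y (spinRaise (d y))ᴴ
        + siteHom x (spinRaise (d x))ᴴ * siteHom y (spinRaise (d y))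
        + (2 : ℂ) • (siteHom x (spinZ (d x)) * siteHom y (spinZ (d y)))) := by
  have casimir (z : Λ) : siteHom z (spinX (d z)) ^ 2 + siteHom z (spinY (d z)) ^ 2
      + siteHom z (spinZ (d z)) ^ 2 = ((d z : ℂ) / 2 * ((d z : ℂ) / 2 + 1)) • (1 : Obs d Λ) := by
    rw [← map_pow, ← map_pow, ← map_pow, ← map_add, ← map_add, spin_casimir, map_smul, map_one]
  have cross : (2 : ℂ) • (siteHom x (spinX (d x)) * siteHom y (spinX (d y))
        + siteHom x (spinY (d x)) * siteHom y (spinY (d y)))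
      = siteHom x (spinRaise (d x)) * siteHom y (spinRaise (d y))ᴴ
        + siteHom x (spinRaise (d x))ᴴ * siteHom y (spinRaise (d y)) := by
    have hI : (1 / (2 * Complex.I)) * (1 / (2 * Complex.I)) = (-(1 / 4) : ℂ) := by
      rw [div_mul_div_comm, mul_mul_mul_comm, Complex.I_mul_I]; norm_num
    simp only [spinX, spinY, map_smul, map_add, map_sub, smul_mul_smul_comm, hI, add_mul, mul_add,
      sub_mul, mul_sub]
    module
  rw [add_smul, ← casimir x, ← casimir y, ← cross, pairCasimir]
  simp only [← siteHom_apply, (siteHom_commute h _ _).add_sq, two_mul, add_mul]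
  module

theorem bond_mul_conjTranspose {x y : Λ} (h : x ≠ y) :
    bond d Λ x y * (bond d Λ x y)ᴴ =
      ((((d x : ℂ) + (d y : ℂ)) / 2) * (((d x : ℂ) + (d y : ℂ)) / 2 + 1)) • 1
        - pairCasimir d Λ x y := by
  have adj (M : Matrix (Fin (d x + 1)) (Fin (d x + 1)) ℂ)
      (N : Matrix (Fin (d y + 1)) (Fin (d y + 1)) ℂ) :
      (siteHom x M * siteHom y N)ᴴ = siteHom x Mᴴ * siteHom y Nᴴ := by
    rw [Matrix.conjTranspose_mul, siteHom_conjTranspose, siteHom_conjTranspose,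
      ← siteHom_conjTranspose, ← siteHom_conjTranspose, (siteHom_commute h _ _).eq]
  have mul (M M' : Matrix (Fin (d x + 1)) (Fin (d x + 1)) ℂ)
      (N N' : Matrix (Fin (d y + 1)) (Fin (d y + 1)) ℂ) :
      siteHom x M * siteHom y N * (siteHom x M' * siteHom y N') =
        siteHom x (M * M') * siteHom y (N * N') := by
    rw [(siteHom_commute h M' N).symm.mul_mul_mul_comm, map_mul, map_mul]
  rw [pairCasimir_eq h, bond, Matrix.conjTranspose_sub, adj, adj, createSecond_conjTranspose,
    createSecond_conjTranspose, sub_mul, mul_sub, mul_sub, mul, mul, mul, mul,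
    createFirst_mul_conjTranspose, createFirst_mul_conjTranspose, createSecond_mul_self,
    createSecond_mul_self, createFirst_mul_createSecond, createFirst_mul_createSecond,
    createSecond_mul_createFirst_conjTranspose, createSecond_mul_createFirst_conjTranspose]
  simp only [map_add, map_sub, map_smul, map_one, add_mul, sub_mul, mul_add, mul_sub,
    smul_mul_assoc, mul_smul_comm, one_mul, mul_one]
  module

theorem mem_maxSpinSpace_iff {x y : Λ} (h : x ≠ y) (φ : EuclideanSpace ℂ (Conf d Λ)) :
    φ ∈ maxSpinSpace d Λ x y ↔ (bond d Λ x y)ᴴ *ᵥ φ.ofLp = 0 := by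
  rw [← Matrix.self_mul_conjTranspose_mulVec_eq_zero, bond_mul_conjTranspose h,
    Matrix.sub_mulVec, Matrix.smul_mulVec, Matrix.one_mulVec, maxSpinSpace,
    Module.End.mem_eigenspace_iff, ← (WithLp.ofLp_injective 2).eq_iff, sub_eq_zero, eq_comm]
  rfl

theorem maxSpinSpace_eq_orthogonal_range {x y : Λ} (h : x ≠ y) :
    maxSpinSpace d Λ x y = (LinearMap.range (Matrix.toEuclideanLin (bond d Λ x y)))ᗮ := by
  ext φ
  rw [mem_maxSpinSpace_iff h, LinearMap.orthogonal_range,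
    ← Matrix.toEuclideanLin_conjTranspose_eq_adjoint, LinearMap.mem_ker,
    ← (WithLp.ofLp_injective 2).eq_iff]
  rfl

theorem starProjection_maxSpinSpace_eq_zero_iff {x y : Λ} (h : x ≠ y)
    (ψ : EuclideanSpace ℂ (Conf d Λ)) :
    (maxSpinSpace d Λ x y).starProjection ψ = 0 ↔
      ∃ χ : Conf d Λ → ℂ, bond d Λ x y *ᵥ χ = ψ.ofLp := by
  rw [Submodule.starProjection_apply_eq_zero_iff, maxSpinSpace_eq_orthogonal_range h,
    Submodule.orthogonal_orthogonal, LinearMap.mem_range]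
  refine ⟨fun ⟨χ, hχ⟩ => ⟨χ.ofLp, ?_⟩, fun ⟨χ, hχ⟩ => ⟨WithLp.toLp 2 χ, ?_⟩⟩
  · rw [← hχ]; rfl
  · exact WithLp.ofLp_injective 2 hχ

end Bond

/-! ### Partial traces -/

section PartialTrace

variable {V : Type*} [DecidableEq V] {d : V → ℕ} {Λ Λ' : Finset V}

/-- The configuration on `Λ'` that is `σ` on `Λ` and `ξ` elsewhere. -/
def glue (σ : Conf d Λ) (ξ : Conf d (Λ' \ Λ)) : Conf d Λ' := fun y =>
  if hy : (y : V) ∈ Λ then σ ⟨y, hy⟩ else ξ ⟨y, Finset.mem_sdiff.2 ⟨y.2, hy⟩⟩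

theorem glue_of_mem (σ : Conf d Λ) (ξ : Conf d (Λ' \ Λ)) (y : Λ') (hy : (y : V) ∈ Λ) :
    glue σ ξ y = σ ⟨y, hy⟩ := dif_pos hy

theorem glue_of_notMem (σ : Conf d Λ) (ξ : Conf d (Λ' \ Λ)) (y : Λ') (hy : (y : V) ∉ Λ) :
    glue σ ξ y = ξ ⟨y, Finset.mem_sdiff.2 ⟨y.2, hy⟩⟩ := dif_neg hy

theorem glue_left (σ : Conf d Λ) (ξ : Conf d (Λ' \ Λ)) (x : Λ) (hx : (x : V) ∈ Λ') :
    glue σ ξ ⟨x, hx⟩ = σ x := dif_pos x.2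

theorem glue_right (σ : Conf d Λ) (ξ : Conf d (Λ' \ Λ)) (x : (Λ' \ Λ : Finset V))
    (hx : (x : V) ∈ Λ') : glue σ ξ ⟨x, hx⟩ = ξ x := dif_neg (Finset.mem_sdiff.1 x.2).2

/-- A configuration on `Λ'` is a pair of configurations on `Λ` and on its complement. -/
def glueEquiv (d : V → ℕ) (h : Λ ⊆ Λ') : Conf d Λ × Conf d (Λ' \ Λ) ≃ Conf d Λ' where
  toFun p := glue p.1 p.2
  invFun σ := (fun x => σ ⟨x, h x.2⟩, fun x => σ ⟨x, (Finset.mem_sdiff.1 x.2).1⟩)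
  left_inv p := Prod.ext (funext fun x => glue_left p.1 p.2 x (h x.2))
    (funext fun x => glue_right p.1 p.2 x (Finset.mem_sdiff.1 x.2).1)
  right_inv σ := by
    ext y
    by_cases hy : (y : V) ∈ Λ
    · simp [glue_of_mem _ _ _ hy]
    · simp [glue_of_notMem _ _ _ hy]

theorem sum_glue (h : Λ ⊆ Λ') {M : Type*} [AddCommMonoid M] (f : Conf d Λ' → M) :
    ∑ σ, f σ = ∑ σ : Conf d Λ, ∑ ξ : Conf d (Λ' \ Λ), f (glue σ ξ) := by
  rw [← Fintype.sum_prod_type', ← (glueEquiv d h).sum_comp]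
  rfl

theorem extend_glue (h : Λ ⊆ Λ') (A : Obs d Λ) (σ τ : Conf d Λ) (ξ η : Conf d (Λ' \ Λ)) :
    extend h A (glue σ ξ) (glue τ η) = if ξ = η then A σ τ else 0 := by
  have agree_iff : (∀ y : Λ', (y : V) ∉ Λ → glue σ ξ y = glue τ η y) ↔ ξ = η := by
    refine ⟨fun H => funext fun x => ?_, ?_⟩
    · obtain ⟨hx, hx'⟩ := Finset.mem_sdiff.1 x.2
      exact (glue_right σ ξ x hx).symm.trans ((H ⟨x, hx⟩ hx').trans (glue_right τ η x hx))
    · rintro rfl y hy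
      rw [glue_of_notMem _ _ _ hy, glue_of_notMem _ _ _ hy]
  simp only [extend, Matrix.of_apply, agree_iff]
  congr 2 <;> ext x <;> simp [glue_of_mem]

theorem extend_extend {Λ₀ : Finset V} (h₀ : Λ₀ ⊆ Λ) (h : Λ ⊆ Λ') (A : Obs d Λ₀) :
    extend h (extend h₀ A) = extend (h₀.trans h) A := by
  ext σ τ
  simp only [extend, Matrix.of_apply, ← ite_and]
  refine if_congr ⟨?_, fun H => ?_⟩ rfl rfl
  · rintro ⟨h1, h2⟩ y hy
    by_cases hy' : (y : V) ∈ Λ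
    · exact h2 ⟨y, hy'⟩ hy
    · exact h1 y hy'
  · exact ⟨fun y hy => H y fun hy' => hy (h₀ hy'), fun y hy => H ⟨y, h y.2⟩ hy⟩

/-- The partial trace of `ρ` over the sites outside `Λ`. -/
def partialTrace (Λ : Finset V) (ρ : Obs d Λ') : Obs d Λ :=
  ∑ ξ : Conf d (Λ' \ Λ), ρ.submatrix (fun σ => glue σ ξ) (fun σ => glue σ ξ)

theorem partialTrace_apply (ρ : Obs d Λ') (σ τ : Conf d Λ) :
    partialTrace Λ ρ σ τ = ∑ ξ : Conf d (Λ' \ Λ), ρ (glue σ ξ) (glue τ ξ) := by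
  simp [partialTrace, Matrix.sum_apply]

theorem trace_partialTrace_mul (h : Λ ⊆ Λ') (ρ : Obs d Λ') (A : Obs d Λ) :
    (partialTrace Λ ρ * A).trace = (ρ * extend h A).trace := by
  simp only [Matrix.trace, Matrix.diag_apply, Matrix.mul_apply, sum_glue h, extend_glue, mul_ite,
    mul_zero, Finset.sum_ite_eq', Finset.mem_univ, if_true, partialTrace_apply, Finset.sum_mul]
  exact Finset.sum_congr rfl fun σ _ => Finset.sum_comm

theorem trace_partialTrace (h : Λ ⊆ Λ') (ρ : Obs d Λ') : (partialTrace Λ ρ).trace = ρ.trace := by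
  simp only [Matrix.trace, Matrix.diag_apply, partialTrace_apply, sum_glue h]

theorem expectation_partialTrace {Λ₀ : Finset V} (h₀ : Λ₀ ⊆ Λ) (h : Λ ⊆ Λ') (ρ : Obs d Λ')
    (A : Obs d Λ₀) : expectation (partialTrace Λ ρ) Λ₀ A = expectation ρ Λ₀ A := by
  rw [expectation, expectation, dif_pos h₀, dif_pos (h₀.trans h), trace_partialTrace_mul h,
    extend_extend]

theorem continuous_expectation (Λ : Finset V) (A : Obs d Λ) :
    Continuous fun ρ : Obs d Λ' => expectation ρ Λ A := by
  unfold expectation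
  split_ifs
  · exact (continuous_id.matrix_mul continuous_const).matrix_trace
  · exact continuous_const

/-- The vector of the values of `ψ` at the configurations that are `ξ` outside `Λ`. -/
def slice (ξ : Conf d (Λ' \ Λ)) : (Conf d Λ' → ℂ) →ₗ[ℂ] Conf d Λ → ℂ :=
  LinearMap.funLeft ℂ ℂ fun σ => glue σ ξ

theorem slice_apply (ξ : Conf d (Λ' \ Λ)) (ψ : Conf d Λ' → ℂ) (σ : Conf d Λ) :
    slice ξ ψ σ = ψ (glue σ ξ) := rfl

theorem partialTrace_col (ρ : Obs d Λ') (τ : Conf d Λ) :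
    (partialTrace Λ ρ).col τ = ∑ ξ : Conf d (Λ' \ Λ), slice ξ (ρ.col (glue τ ξ)) := by
  ext σ
  simp [partialTrace_apply, slice_apply]

theorem glue_update (x : Λ) (h : (x : V) ∈ Λ') (σ : Conf d Λ) (ξ : Conf d (Λ' \ Λ))
    (j : Fin (d x + 1)) :
    glue (Function.update σ x j) ξ = Function.update (glue σ ξ : Conf d Λ') (⟨x, h⟩ : Λ') j := by
  refine Function.eq_update_iff.2 ⟨?_, fun y hyx => ?_⟩
  · rw [glue_left _ ξ x h, Function.update_self]
  by_cases hy : (y : V) ∈ Λ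
  · have hyx' : (⟨y, hy⟩ : Λ) ≠ x := fun e => hyx (Subtype.ext (congrArg (fun z : Λ => (z : V)) e))
    rw [glue_of_mem _ _ _ hy, glue_of_mem _ _ _ hy, Function.update_of_ne hyx']
  · rw [glue_of_notMem _ _ _ hy, glue_of_notMem _ _ _ hy]

theorem slice_siteHom_mulVec (x : Λ) (h : (x : V) ∈ Λ')
    (M : Matrix (Fin (d x + 1)) (Fin (d x + 1)) ℂ) (χ : Conf d Λ' → ℂ) (ξ : Conf d (Λ' \ Λ)) :
    slice ξ (siteHom (d := d) (⟨x, h⟩ : Λ') M *ᵥ χ) = siteHom x M *ᵥ slice ξ χ := by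
  ext σ
  rw [siteHom_apply x, onSite_mulVec]
  refine (onSite_mulVec _ _ _ _).trans (Finset.sum_congr rfl fun j _ => ?_)
  exact congrArg₂ (· * ·) (congrArg (fun i => M i j) (glue_left σ ξ x h))
    (congrArg χ (glue_update x h σ ξ j).symm)

theorem slice_bond_mulVec (x y : Λ) (hx : (x : V) ∈ Λ') (hy : (y : V) ∈ Λ')
    (χ : Conf d Λ' → ℂ) (ξ : Conf d (Λ' \ Λ)) :
    slice ξ (bond d Λ' ⟨x, hx⟩ ⟨y, hy⟩ *ᵥ χ) = bond d Λ x y *ᵥ slice ξ χ := by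
  simp only [bond, Matrix.sub_mulVec, ← Matrix.mulVec_mulVec, map_sub, ← slice_siteHom_mulVec x hx,
    ← slice_siteHom_mulVec y hy]

end PartialTrace

/-! ### Ground states -/

theorem norm_apply_le_re_trace_of_posSemidef {ι : Type*} [Fintype ι] {A : Matrix ι ι ℂ}
    (hA : A.PosSemidef) (i j : ι) : ‖A i j‖ ≤ A.trace.re := by
  obtain ⟨m, v, rfl⟩ := Matrix.posSemidef_iff_eq_sum_vecMulVec.1 hA
  have trace_eq : (∑ k, Matrix.vecMulVec (v k) (star (v k))).trace.re =
      ∑ l, ∑ k, ‖v k l‖ ^ 2 := by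
    simp [Matrix.trace, Matrix.sum_apply, Matrix.vecMulVec_apply, Complex.mul_conj',
      ← Complex.ofReal_pow]
  have diagonal_le (l : ι) : ∑ k, ‖v k l‖ ^ 2 ≤ ∑ l, ∑ k, ‖v k l‖ ^ 2 :=
    Finset.single_le_sum (f := fun l => ∑ k, ‖v k l‖ ^ 2)
      (fun _ _ => Finset.sum_nonneg fun _ _ => sq_nonneg _) (Finset.mem_univ l)
  calc ‖(∑ k, Matrix.vecMulVec (v k) (star (v k))) i j‖ ≤ ∑ k, ‖v k i‖ * ‖v k j‖ := by
        rw [Matrix.sum_apply]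
        refine (norm_sum_le _ _).trans (Finset.sum_le_sum fun k _ => ?_)
        simp [Matrix.vecMulVec_apply]
    _ ≤ ∑ k, (‖v k i‖ ^ 2 + ‖v k j‖ ^ 2) / 2 :=
        Finset.sum_le_sum fun k _ => by linarith [two_mul_le_add_sq ‖v k i‖ ‖v k j‖]
    _ ≤ (∑ k, Matrix.vecMulVec (v k) (star (v k))).trace.re := by
        rw [← Finset.sum_div, Finset.sum_add_distrib, trace_eq]
        linarith [diagonal_le i, diagonal_le j]

/-- Frustration-freeness: the energy is a sum of nonnegative terms. -/
theorem sum_starProjection_apply_eq_zero_iff {E ι : Type*} [NormedAddCommGroup E]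
    [InnerProductSpace ℂ E] (s : Finset ι) (K : ι → Submodule ℂ E)
    [∀ i, (K i).HasOrthogonalProjection] (ψ : E) :
    (∑ i ∈ s, (K i).starProjection) ψ = 0 ↔ ∀ i ∈ s, (K i).starProjection ψ = 0 := by
  rw [sum_apply]
  refine ⟨fun h => ?_, Finset.sum_eq_zero⟩
  have energy_eq_zero : ∑ i ∈ s, RCLike.re (inner ℂ ((K i).starProjection ψ) ψ) = 0 := by
    rw [← map_sum, ← sum_inner, h, inner_zero_left, map_zero]
  intro i hi
  have := (Finset.sum_eq_zero_iff_of_nonneg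
    fun i _ => (K i).re_inner_starProjection_nonneg ψ).1 energy_eq_zero i hi
  rw [Submodule.re_inner_starProjection_eq_normSq, sq_eq_zero_iff, norm_eq_zero] at this
  rw [Submodule.starProjection_apply, this, Submodule.coe_zero]

section GroundState

variable {V : Type*} [DecidableEq V] (G : SimpleGraph V) [G.LocallyFinite]

/-- The space of the vectors that contain a valence bond on every edge of the region `Λ`. -/
def bondedSpace (Λ : Finset V) : Submodule ℂ (Conf (fun v => G.degree v) Λ → ℂ) :=
  ⨅ (x : Λ) (y : Λ) (_ : G.Adj x y), LinearMap.range (bond (fun v => G.degree v) Λ x y).mulVecLin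

variable {G}

theorem mem_bondedSpace {Λ : Finset V} {ψ : Conf (fun v => G.degree v) Λ → ℂ} :
    ψ ∈ bondedSpace G Λ ↔
      ∀ x y : Λ, G.Adj x y → ∃ χ, bond (fun v => G.degree v) Λ x y *ᵥ χ = ψ := by
  simp only [bondedSpace, Submodule.mem_iInf, LinearMap.mem_range, Matrix.mulVecLin_apply]

theorem slice_mem_bondedSpace {Λ Λ' : Finset V} (h : Λ ⊆ Λ')
    {ψ : Conf (fun v => G.degree v) Λ' → ℂ} (hψ : ψ ∈ bondedSpace G Λ')
    (ξ : Conf (fun v => G.degree v) (Λ' \ Λ)) : slice ξ ψ ∈ bondedSpace G Λ := by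
  rw [mem_bondedSpace] at hψ ⊢
  intro x y hxy
  obtain ⟨χ, rfl⟩ := hψ ⟨x, h x.2⟩ ⟨y, h y.2⟩ hxy
  exact ⟨slice ξ χ, (slice_bond_mulVec x y (h x.2) (h y.2) χ ξ).symm⟩

variable (G) in
theorem ball_mono (o : V) : Monotone (ball G o) :=
  monotone_nat_of_le_succ fun _ => Finset.subset_union_left

theorem exists_subset_ball (hG : G.Connected) (o : V) (Λ : Finset V) :
    ∃ n, Λ ⊆ ball G o n :=
  ⟨Λ.sup (G.dist o), fun x hx => (mem_ball G hG o x _).2 (Finset.le_sup (f := G.dist o) hx)⟩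

variable [DecidableRel G.Adj]

theorem hamiltonian_apply_eq_zero_iff {Λ : Finset V}
    (ψ : EuclideanSpace ℂ (Conf (fun v => G.degree v) Λ)) :
    hamiltonian G Λ ψ = 0 ↔ ψ.ofLp ∈ bondedSpace G Λ := by
  rw [hamiltonian, ← Fintype.sum_prod_type', ← Finset.sum_filter, smul_apply,
    smul_eq_zero_iff_right (by norm_num), sum_starProjection_apply_eq_zero_iff, mem_bondedSpace]
  simp only [Finset.mem_filter, Finset.mem_univ, true_and, Prod.forall]
  exact forall₃_congr fun x y hxy =>
    starProjection_maxSpinSpace_eq_zero_iff (fun e => hxy.ne (congrArg Subtype.val e)) ψ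

theorem forall_hamiltonian_toEuclideanLin_eq_zero_iff {Λ : Finset V}
    {ρ : Obs (fun v => G.degree v) Λ} :
    (∀ φ, hamiltonian G Λ (Matrix.toEuclideanLin ρ φ) = 0) ↔
      ∀ τ, ρ.col τ ∈ bondedSpace G Λ := by
  have range_le : LinearMap.range ρ.mulVecLin ≤ bondedSpace G Λ ↔
      ∀ τ, ρ.col τ ∈ bondedSpace G Λ := by
    rw [Matrix.range_mulVecLin, Submodule.span_le, Set.range_subset_iff]
    rfl
  rw [← range_le]
  simp only [hamiltonian_apply_eq_zero_iff]
  constructor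
  · rintro h _ ⟨χ, rfl⟩
    exact h (WithLp.toLp 2 χ)
  · exact fun h φ => h ⟨φ.ofLp, rfl⟩

theorem IsGroundState.partialTrace {Λ Λ' : Finset V} (h : Λ ⊆ Λ')
    {ρ : Obs (fun v => G.degree v) Λ'} (hρ : IsGroundState G Λ' ρ) :
    IsGroundState G Λ (partialTrace Λ ρ) where
  posSemidef := Matrix.posSemidef_sum _ fun _ _ => hρ.posSemidef.submatrix _
  trace_eq_one := (trace_partialTrace h ρ).trans hρ.trace_eq_one
  hamiltonian_eq_zero := by
    refine forall_hamiltonian_toEuclideanLin_eq_zero_iff.2 fun τ => ?_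
    rw [partialTrace_col]
    exact Submodule.sum_mem _ fun ξ _ => slice_mem_bondedSpace h
      (forall_hamiltonian_toEuclideanLin_eq_zero_iff.1 hρ.hamiltonian_eq_zero _) ξ

theorem IsGroundState.norm_apply_le_one {Λ : Finset V} {ρ : Obs (fun v => G.degree v) Λ}
    (hρ : IsGroundState G Λ ρ) (σ τ : Conf (fun v => G.degree v) Λ) : ‖ρ σ τ‖ ≤ 1 := by
  simpa [hρ.trace_eq_one] using norm_apply_le_re_trace_of_posSemidef hρ.posSemidef σ τ

theorem isClosed_setOf_isGroundState (Λ : Finset V) :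
    IsClosed {ρ : Obs (fun v => G.degree v) Λ | IsGroundState G Λ ρ} := by
  have eq_inter : {ρ : Obs (fun v => G.degree v) Λ | IsGroundState G Λ ρ} =
      ({ρ | ρᴴ = ρ} ∩ ⋂ x : Conf (fun v => G.degree v) Λ → ℂ, {ρ | 0 ≤ star x ⬝ᵥ (ρ *ᵥ x)})
        ∩ {ρ | ρ.trace = 1}
        ∩ ⋂ φ, {ρ | hamiltonian G Λ (Matrix.toEuclideanLin ρ φ) = 0} := by
    ext ρ
    simp only [Set.mem_inter_iff, Set.mem_iInter, Set.mem_ofPred_eq]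
    exact ⟨fun h => ⟨⟨⟨h.posSemidef.isHermitian, h.posSemidef.dotProduct_mulVec_nonneg⟩,
      h.trace_eq_one⟩, h.hamiltonian_eq_zero⟩,
      fun ⟨⟨⟨h1, h2⟩, h3⟩, h4⟩ => ⟨.of_dotProduct_mulVec_nonneg h1 h2, h3, h4⟩⟩
  rw [eq_inter]
  refine ((IsClosed.inter ?_ ?_).inter ?_).inter ?_
  · exact isClosed_eq continuous_id.matrix_conjTranspose continuous_id
  · exact isClosed_iInter fun x => isClosed_le continuous_const
      (continuous_const.dotProduct (continuous_id.matrix_mulVec continuous_const))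
  · exact isClosed_eq continuous_id.matrix_trace continuous_const
  · exact isClosed_iInter fun φ => isClosed_eq ((hamiltonian G Λ).continuous.comp
      ((PiLp.continuous_toLp 2 _).comp (continuous_id.matrix_mulVec continuous_const)))
      continuous_const

/-- The density matrix of the pure state of the direction `ψ`, which need not be normalized
(junk for `ψ = 0`). -/
def pureState {ι : Type*} [Fintype ι] (ψ : ι → ℂ) : Matrix ι ι ℂ :=
  (ψ ⬝ᵥ star ψ)⁻¹ • Matrix.vecMulVec ψ (star ψ)

theorem isGroundState_pureState {Λ : Finset V} {ψ : Conf (fun v => G.degree v) Λ → ℂ}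
    (hψ : ψ ∈ bondedSpace G Λ) (h0 : ψ ≠ 0) : IsGroundState G Λ (pureState ψ) where
  posSemidef := (Matrix.posSemidef_vecMulVec_self_star ψ).smul
    (inv_nonneg.2 (dotProduct_self_star_nonneg ψ))
  trace_eq_one := by
    rw [pureState, Matrix.trace_smul, Matrix.trace_vecMulVec, smul_eq_mul,
      inv_mul_cancel₀ (mt dotProduct_self_star_eq_zero.1 h0)]
  hamiltonian_eq_zero := by
    refine forall_hamiltonian_toEuclideanLin_eq_zero_iff.2 fun τ => ?_
    have col_eq : (pureState ψ).col τ = ((ψ ⬝ᵥ star ψ)⁻¹ * star (ψ τ)) • ψ := by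
      ext σ
      simp [pureState, Matrix.vecMulVec_apply, mul_assoc, mul_comm]
    exact col_eq ▸ Submodule.smul_mem _ _ hψ

/-! ### Infinite-volume limits -/

theorem exists_tendsto_partialTrace {Λ : Finset V} (𝓤 : Ultrafilter ℕ) {Λ' : ℕ → Finset V}
    (hΛ : ∀ᶠ m in 𝓤, Λ ⊆ Λ' m) (ρ : ∀ m, Obs (fun v => G.degree v) (Λ' m))
    (hρ : ∀ m, IsGroundState G (Λ' m) (ρ m)) :
    ∃ R, IsGroundState G Λ R ∧ Tendsto (fun m => partialTrace Λ (ρ m)) 𝓤 (𝓝 R) := by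
  have ground : ∀ᶠ m in 𝓤, IsGroundState G Λ (partialTrace Λ (ρ m)) :=
    hΛ.mono fun m hm => (hρ m).partialTrace hm
  have entry (σ τ) : ∃ r : ℂ, Tendsto (fun m => partialTrace Λ (ρ m) σ τ) 𝓤 (𝓝 r) := by
    obtain ⟨r, -, hr⟩ := (isCompact_closedBall (0 : ℂ) 1).ultrafilter_le_nhds
      (𝓤.map fun m => partialTrace Λ (ρ m) σ τ) (le_principal_iff.2 <| ground.mono fun m hm =>
        mem_closedBall_zero_iff.2 (hm.norm_apply_le_one σ τ))
    exact ⟨r, hr⟩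
  choose r hr using entry
  have lim : Tendsto (fun m => partialTrace Λ (ρ m)) 𝓤 (𝓝 (Matrix.of r)) :=
    tendsto_pi_nhds.2 fun σ => tendsto_pi_nhds.2 fun τ => hr σ τ
  exact ⟨_, (isClosed_setOf_isGroundState Λ).mem_of_tendsto lim ground, lim⟩

theorem exists_infiniteVolumeGroundState_tendsto (hG : G.Connected) (o : V)
    (ρ : ∀ n, Obs (fun v => G.degree v) (ball G o n))
    (hρ : ∀ n, IsGroundState G (ball G o n) (ρ n)) :
    ∃ ω ∈ infiniteVolumeGroundStates G o, ∀ Λ A,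
      Tendsto (fun n => expectation (ρ n) Λ A) (hyperfilter ℕ) (𝓝 (ω Λ A)) := by
  have eventually_subset (n : ℕ) : ∀ᶠ m in hyperfilter ℕ, ball G o n ⊆ ball G o m :=
    Nat.hyperfilter_le_atTop ((eventually_ge_atTop n).mono fun _ hm => ball_mono G o hm)
  choose R hR hlim using fun n => exists_tendsto_partialTrace _ (eventually_subset n) ρ hρ
  have tendsto_R {Λ : Finset V} (A : Obs (fun v => G.degree v) Λ) {n : ℕ} (hn : Λ ⊆ ball G o n) :
      Tendsto (fun m => expectation (ρ m) Λ A) (hyperfilter ℕ) (𝓝 (expectation (R n) Λ A)) :=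
    (((continuous_expectation Λ A).tendsto (R n)).comp (hlim n)).congr' <|
      (eventually_subset n).mono fun _ hm => expectation_partialTrace hn hm _ _
  choose N hN using exists_subset_ball hG o
  refine ⟨fun Λ A => expectation (R (N Λ)) Λ A, ⟨R, hR, fun Λ A => ?_⟩,
    fun Λ A => tendsto_R A (hN Λ)⟩
  refine tendsto_const_nhds.congr' ?_
  filter_upwards [eventually_ge_atTop (N Λ)] with m hm
  exact tendsto_nhds_unique (tendsto_R A (hN Λ)) (tendsto_R A ((hN Λ).trans (ball_mono G o hm)))

end GroundState

/-! ### Products of affine functions -/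

theorem integral_mul_integral_le_of_monovaryOn {f g : ℝ → ℝ} {a b : ℝ} (hab : a ≤ b)
    (hf : IntervalIntegrable f MeasureTheory.volume a b)
    (hg : IntervalIntegrable g MeasureTheory.volume a b)
    (hfg : IntervalIntegrable (fun t => f t * g t) MeasureTheory.volume a b)
    (hmono : MonovaryOn f g (Set.Icc a b)) :
    (∫ t in a..b, f t) * (∫ t in a..b, g t) ≤ (b - a) * ∫ t in a..b, f t * g t := by
  set F := ∫ t in a..b, f t
  set H := ∫ t in a..b, g t
  set K := ∫ t in a..b, f t * g t
  have inner (s : ℝ) : ∫ t in a..b, (f t - f s) * (g t - g s) =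
      K - g s * F - f s * H + (b - a) * (f s * g s) := by
    have expand : (fun t => (f t - f s) * (g t - g s)) =
        fun t => f t * g t - g s * f t - f s * g t + f s * g s := by
      funext t; ring
    rw [expand, intervalIntegral.integral_add
        ((hfg.sub (hf.const_mul _)).sub (hg.const_mul _)) intervalIntegrable_const,
      intervalIntegral.integral_sub (hfg.sub (hf.const_mul _)) (hg.const_mul _),
      intervalIntegral.integral_sub hfg (hf.const_mul _), intervalIntegral.integral_const_mul,
      intervalIntegral.integral_const_mul, intervalIntegral.integral_const, smul_eq_mul]
  have outer : ∫ s in a..b, (K - g s * F - f s * H + (b - a) * (f s * g s)) =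
      2 * ((b - a) * K - F * H) := by
    rw [intervalIntegral.integral_add
        ((intervalIntegrable_const.sub (hg.mul_const _)).sub (hf.mul_const _))
        (hfg.const_mul _),
      intervalIntegral.integral_sub (intervalIntegrable_const.sub (hg.mul_const _))
        (hf.mul_const _),
      intervalIntegral.integral_sub intervalIntegrable_const (hg.mul_const _),
      intervalIntegral.integral_mul_const, intervalIntegral.integral_mul_const,
      intervalIntegral.integral_const_mul, intervalIntegral.integral_const, smul_eq_mul]
    ring
  have nonneg : 0 ≤ ∫ s in a..b, ∫ t in a..b, (f t - f s) * (g t - g s) :=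
    intervalIntegral.integral_nonneg hab fun s hs =>
      intervalIntegral.integral_nonneg hab fun t ht =>
        monovaryOn_iff_forall_mul_nonneg.1 hmono hs ht
  simp only [inner, outer] at nonneg
  linarith

theorem integral_comp_two_mul_sub_one {g : ℝ → ℝ} (hg : Continuous g) :
    ∫ t in (0 : ℝ)..1, g (2 * t - 1) = 1 / 2 * ∫ s in (0 : ℝ)..1, (g s + g (-s)) := by
  rw [intervalIntegral.integral_comp_mul_sub g two_ne_zero,
    intervalIntegral.integral_add (hg.intervalIntegrable _ _)
      (Continuous.intervalIntegrable (by fun_prop) _ _),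
    intervalIntegral.integral_comp_neg g, neg_zero, add_comm,
    intervalIntegral.integral_add_adjacent_intervals (hg.intervalIntegrable _ _)
      (hg.intervalIntegrable _ _)]
  norm_num

section Affine

variable {ι : Type*} {I : Finset ι} {β : ι → ℝ}

theorem one_add_two_mul_sum_mul_prod_one_sub_le (h0 : ∀ i ∈ I, 0 ≤ β i) (h1 : ∀ i ∈ I, β i ≤ 1) :
    (1 + 2 * ∑ i ∈ I, β i) * ∏ i ∈ I, (1 - β i) ≤ ∏ i ∈ I, (1 + β i) := by
  classical
  induction I using Finset.induction_on with
  | empty => simp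
  | insert a I ha ih =>
    rw [Finset.forall_mem_insert] at h0 h1
    rw [Finset.prod_insert ha, Finset.prod_insert ha, Finset.sum_insert ha]
    have hB : 0 ≤ ∏ i ∈ I, (1 - β i) := Finset.prod_nonneg fun i hi => sub_nonneg.2 (h1.2 i hi)
    have hX : 0 ≤ ∑ i ∈ I, β i := Finset.sum_nonneg h0.2
    set X := ∑ i ∈ I, β i
    calc (1 + 2 * (β a + X)) * ((1 - β a) * ∏ i ∈ I, (1 - β i))
        = (1 + 2 * (β a + X)) * (1 - β a) * ∏ i ∈ I, (1 - β i) := by ring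
      _ ≤ (1 + β a) * (1 + 2 * X) * ∏ i ∈ I, (1 - β i) := by
          refine mul_le_mul_of_nonneg_right ?_ hB
          nlinarith [mul_nonneg h0.1 hX, sq_nonneg (β a)]
      _ = (1 + β a) * ((1 + 2 * X) * ∏ i ∈ I, (1 - β i)) := by ring
      _ ≤ (1 + β a) * ∏ i ∈ I, (1 + β i) :=
          mul_le_mul_of_nonneg_left (ih h0.2 h1.2) (by linarith [h0.1])

/-- Both parts are treated at once because inserting a factor mixes them. -/
theorem monotoneOn_prod_even_and_odd (h0 : ∀ i ∈ I, 0 ≤ β i) :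
    MonotoneOn (fun s => ∏ i ∈ I, (1 + β i * s) + ∏ i ∈ I, (1 - β i * s)) (Set.Ici 0) ∧
    MonotoneOn (fun s => ∏ i ∈ I, (1 + β i * s) - ∏ i ∈ I, (1 - β i * s)) (Set.Ici 0) := by
  classical
  induction I using Finset.induction_on with
  | empty => simp [monotoneOn_const]
  | insert a I ha ih =>
    rw [Finset.forall_mem_insert] at h0
    obtain ⟨even, odd⟩ := ih h0.2
    set E := fun s => ∏ i ∈ I, (1 + β i * s) + ∏ i ∈ I, (1 - β i * s) with hE
    set O := fun s => ∏ i ∈ I, (1 + β i * s) - ∏ i ∈ I, (1 - β i * s) with hO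
    have even_nonneg {s : ℝ} (hs : s ∈ Set.Ici 0) : 0 ≤ E s := by
      refine le_trans ?_ (even Set.self_mem_Ici hs hs)
      simp [hE]
    have odd_nonneg {s : ℝ} (hs : s ∈ Set.Ici 0) : 0 ≤ O s := by
      refine le_trans ?_ (odd Set.self_mem_Ici hs hs)
      simp [hO]
    have hlin : MonotoneOn (fun s => β a * s) (Set.Ici 0) := fun _ _ _ _ h =>
      mul_le_mul_of_nonneg_left h h0.1
    have hlin_nonneg {s : ℝ} (hs : s ∈ Set.Ici 0) : 0 ≤ β a * s := mul_nonneg h0.1 hs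
    simp only [Finset.prod_insert ha]
    constructor
    · refine (even.add (hlin.mul odd (fun _ => hlin_nonneg) fun _ => odd_nonneg)).congr
        fun s _ => ?_
      simp only [Pi.mul_apply, hE, hO]
      ring
    · refine (odd.add (hlin.mul even (fun _ => hlin_nonneg) fun _ => even_nonneg)).congr
        fun s _ => ?_
      simp only [Pi.mul_apply, hE, hO]
      ring

theorem sum_mul_prod_even_le_prod_odd (h0 : ∀ i ∈ I, 0 ≤ β i) (h1 : ∀ i ∈ I, β i ≤ 1) {s : ℝ}
    (hs0 : 0 ≤ s) (hs1 : s ≤ 1) :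
    (∑ i ∈ I, β i) * s * (∏ i ∈ I, (1 + β i * s) + ∏ i ∈ I, (1 - β i * s)) ≤
      (1 + ∑ i ∈ I, β i) * (∏ i ∈ I, (1 + β i * s) - ∏ i ∈ I, (1 - β i * s)) := by
  have ratio := one_add_two_mul_sum_mul_prod_one_sub_le (I := I) (β := fun i => β i * s)
    (fun i hi => mul_nonneg (h0 i hi) hs0) (fun i hi => mul_le_one₀ (h1 i hi) hs0 hs1)
  have odd_nonneg : 0 ≤ ∏ i ∈ I, (1 + β i * s) - ∏ i ∈ I, (1 - β i * s) := by
    simpa using (monotoneOn_prod_even_and_odd h0).2 Set.self_mem_Ici hs0 hs0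
  rw [← Finset.sum_mul] at ratio
  nlinarith [mul_nonneg (mul_nonneg (Finset.sum_nonneg h0) (sub_nonneg.2 hs1)) odd_nonneg]

theorem integral_prod_even_le (h0 : ∀ i ∈ I, 0 ≤ β i) :
    ∫ s in (0 : ℝ)..1, (∏ i ∈ I, (1 + β i * s) + ∏ i ∈ I, (1 - β i * s)) ≤
      3 * ∫ s in (0 : ℝ)..1, s ^ 2 * (∏ i ∈ I, (1 + β i * s) + ∏ i ∈ I, (1 - β i * s)) := by
  have sq_mono : MonotoneOn (fun s : ℝ => s ^ 2) (Set.Icc 0 1) :=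
    (pow_left_monotoneOn (n := 2)).mono fun s hs => hs.1
  have even_mono := (monotoneOn_prod_even_and_odd h0).1.mono
    (Set.Icc_subset_Ici_self : Set.Icc (0 : ℝ) 1 ⊆ _)
  have chebyshev := integral_mul_integral_le_of_monovaryOn zero_le_one
    (Continuous.intervalIntegrable (by fun_prop) _ _)
    (Continuous.intervalIntegrable (by fun_prop) _ _)
    (Continuous.intervalIntegrable (by fun_prop) _ _) (sq_mono.monovaryOn even_mono)
  rw [integral_pow] at chebyshev
  norm_num at chebyshev
  linarith

theorem sum_mul_integral_prod_le (h0 : ∀ i ∈ I, 0 ≤ β i) (h1 : ∀ i ∈ I, β i ≤ 1) :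
    (∑ i ∈ I, β i) * ∫ t in (0 : ℝ)..1, ∏ i ∈ I, (1 + β i * (2 * t - 1)) ≤
      3 * (1 + ∑ i ∈ I, β i) *
        ∫ t in (0 : ℝ)..1, (2 * t - 1) * ∏ i ∈ I, (1 + β i * (2 * t - 1)) := by
  have hS : 0 ≤ ∑ i ∈ I, β i := Finset.sum_nonneg h0
  rw [integral_comp_two_mul_sub_one (g := fun s => ∏ i ∈ I, (1 + β i * s)) (by fun_prop),
    integral_comp_two_mul_sub_one (g := fun s => s * ∏ i ∈ I, (1 + β i * s)) (by fun_prop)]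
  have odd_bound := intervalIntegral.integral_mono_on (μ := MeasureTheory.volume) zero_le_one
    (f := fun s => (∑ i ∈ I, β i) *
      (s ^ 2 * (∏ i ∈ I, (1 + β i * s) + ∏ i ∈ I, (1 - β i * s))))
    (g := fun s => (1 + ∑ i ∈ I, β i) *
      (s * ∏ i ∈ I, (1 + β i * s) + -s * ∏ i ∈ I, (1 + β i * -s)))
    (Continuous.intervalIntegrable (by fun_prop) _ _)
    (Continuous.intervalIntegrable (by fun_prop) _ _) fun s hs => by
      have := mul_le_mul_of_nonneg_left (sum_mul_prod_even_le_prod_odd h0 h1 hs.1 hs.2) hs.1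
      simp only [mul_neg, ← sub_eq_add_neg]
      linarith
  rw [intervalIntegral.integral_const_mul, intervalIntegral.integral_const_mul] at odd_bound
  have even_bound := mul_le_mul_of_nonneg_left (integral_prod_even_le h0) hS
  simp only [mul_neg, ← sub_eq_add_neg] at odd_bound ⊢
  linarith

theorem integral_prod_pos (h0 : ∀ i ∈ I, 0 ≤ β i) (h1 : ∀ i ∈ I, β i ≤ 1) :
    0 < ∫ t in (0 : ℝ)..1, ∏ i ∈ I, (1 + β i * (2 * t - 1)) := by
  refine intervalIntegral.intervalIntegral_pos_of_pos_on
    (Continuous.intervalIntegrable (by fun_prop) _ _) (fun t ht => ?_) zero_lt_one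
  refine Finset.prod_pos fun i hi => ?_
  nlinarith [h0 i hi, h1 i hi, mul_nonneg (h0 i hi) ht.1.le, ht.1, ht.2]

theorem integral_mul_prod_le (h0 : ∀ i ∈ I, 0 ≤ β i) (h1 : ∀ i ∈ I, β i ≤ 1) :
    ∫ t in (0 : ℝ)..1, (2 * t - 1) * ∏ i ∈ I, (1 + β i * (2 * t - 1)) ≤
      ∫ t in (0 : ℝ)..1, ∏ i ∈ I, (1 + β i * (2 * t - 1)) := by
  refine intervalIntegral.integral_mono_on zero_le_one
    (Continuous.intervalIntegrable (by fun_prop) _ _)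
    (Continuous.intervalIntegrable (by fun_prop) _ _) fun t ht =>
      mul_le_of_le_one_left (Finset.prod_nonneg fun i hi => ?_) (by linarith [ht.2])
  nlinarith [h0 i hi, h1 i hi, ht.1, ht.2]

end Affine

/-! ### Beta integrals -/

/-- The Beta integral `k! (d - k)! / (d + 1)!`, which is the weight of the occupation numbers
`k` and `d - k` of the two boson species at a site of spin `d / 2`. -/
def occWeight (d k : ℕ) : ℝ :=
  ∫ t in (0 : ℝ)..1, t ^ k * (1 - t) ^ (d - k)

theorem occWeight_pos (d k : ℕ) : 0 < occWeight d k := by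
  refine intervalIntegral.intervalIntegral_pos_of_pos_on
    (Continuous.intervalIntegrable (by fun_prop) _ _) (fun t ht => ?_) zero_lt_one
  exact mul_pos (pow_pos ht.1 _) (pow_pos (sub_pos.2 ht.2) _)

theorem occWeight_succ {d k : ℕ} (h : k < d) :
    ((d : ℝ) - k) * occWeight d (k + 1) = (k + 1) * occWeight d k := by
  obtain ⟨m, rfl⟩ := Nat.exists_eq_add_of_lt h
  have deriv_eq (t : ℝ) : HasDerivAt (fun t : ℝ => t ^ (k + 1) * (1 - t) ^ (m + 1))
      (((k : ℝ) + 1) * (t ^ k * (1 - t) ^ (m + 1))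
        - ((m : ℝ) + 1) * (t ^ (k + 1) * (1 - t) ^ m)) t := by
    refine ((hasDerivAt_pow (k + 1) t).mul
      (((hasDerivAt_id t).const_sub 1).pow (m + 1))).congr_deriv ?_
    simp
    ring
  have by_parts := intervalIntegral.integral_eq_sub_of_hasDerivAt (a := 0) (b := 1)
    (fun t _ => deriv_eq t) (Continuous.intervalIntegrable (by fun_prop) _ _)
  rw [intervalIntegral.integral_sub (Continuous.intervalIntegrable (by fun_prop) _ _)
    (Continuous.intervalIntegrable (by fun_prop) _ _), intervalIntegral.integral_const_mul,
    intervalIntegral.integral_const_mul] at by_parts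
  norm_num at by_parts
  simp only [occWeight, show k + m + 1 - (k + 1) = m by omega,
    show k + m + 1 - k = m + 1 by omega]
  push_cast
  linarith

theorem integral_two_mul_sub_one_mul_pow {d k : ℕ} (h : k ≤ d) :
    ∫ t in (0 : ℝ)..1, (2 * t - 1) * (t ^ k * (1 - t) ^ (d - k)) =
      2 / ((d : ℝ) + 2) * (((k : ℝ) - d / 2) * occWeight d k) := by
  have e1 : d + 1 - (k + 1) = d - k := by omega
  have e2 : d + 1 - k = d - k + 1 := by omega
  have hdiff : ∫ t in (0 : ℝ)..1, (2 * t - 1) * (t ^ k * (1 - t) ^ (d - k)) =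
      occWeight (d + 1) (k + 1) - occWeight (d + 1) k := by
    rw [occWeight, occWeight, e1, e2, ← intervalIntegral.integral_sub
      (Continuous.intervalIntegrable (by fun_prop) _ _)
      (Continuous.intervalIntegrable (by fun_prop) _ _)]
    congr 1; ext t; ring
  have hsum : occWeight d k = occWeight (d + 1) (k + 1) + occWeight (d + 1) k := by
    rw [occWeight, occWeight, occWeight, e1, e2, ← intervalIntegral.integral_add
      (Continuous.intervalIntegrable (by fun_prop) _ _)
      (Continuous.intervalIntegrable (by fun_prop) _ _)]
    congr 1; ext t; ring
  have hratio := occWeight_succ (d := d + 1) (k := k) (by omega)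
  push_cast at hratio
  have : (d : ℝ) + 2 ≠ 0 := by positivity
  rw [hdiff, hsum]
  field_simp
  linarith

/-! ### Rooted trees -/

section Tree

variable {V : Type*} (G : SimpleGraph V) [G.LocallyFinite] (o : V)

/-- The children of the vertex `x` in the tree `G` rooted at `o`: its neighbours farther from
the root. -/
def children (x : V) : Finset V :=
  (G.neighborFinset x).filter fun y => G.dist o y = G.dist o x + 1

/-- The first `ℓ` steps of `p` lead from the root to successive children; the values of `p`
beyond `ℓ` are irrelevant. -/
def IsDescending (p : ℕ → V) (ℓ : ℕ) : Prop :=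
  p 0 = o ∧ ∀ k < ℓ, p (k + 1) ∈ children G o (p k)

/-- The branching of the tree exceeds `3` by the factor `μ > 1` on average along every finite
path that starts at the root. -/
def HasGrowth (C μ : ℝ) : Prop :=
  ∀ p ℓ, IsDescending G o p ℓ →
    C * μ ^ ℓ ≤ ∏ k ∈ Finset.Icc 1 ℓ, ((children G o (p k)).card : ℝ) / 3

variable {G o}

theorem mem_children {x y : V} : y ∈ children G o x ↔ G.Adj x y ∧ G.dist o y = G.dist o x + 1 := by
  simp [children]

theorem ne_root_of_mem_children {x y : V} (h : x ∈ children G o y) : x ≠ o := by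
  rintro rfl
  simp [mem_children] at h

theorem card_children_root : (children G o o).card = G.degree o := by
  rw [children, Finset.filter_true_of_mem, SimpleGraph.card_neighborFinset_eq_degree]
  intro y hy
  rw [SimpleGraph.mem_neighborFinset] at hy
  rw [SimpleGraph.dist_self, SimpleGraph.dist_eq_one_iff_adj.2 hy]

theorem eq_of_mem_children (hG : G.IsTree) {x y z : V} (hy : x ∈ children G o y)
    (hz : x ∈ children G o z) : y = z := by
  rw [mem_children] at hy hz
  obtain ⟨p, hp⟩ := hG.connected.exists_walk_length_eq_dist o y
  obtain ⟨q, hq⟩ := hG.connected.exists_walk_length_eq_dist o z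
  have path_y := (p.concat hy.1).isPath_of_length_eq_dist (by simp [hp, hy.2])
  have path_z := (q.concat hz.1).isPath_of_length_eq_dist (by simp [hq, hz.2])
  have path_eq := (hG.isAcyclic.subsingleton_path o x).elim ⟨_, path_y⟩ ⟨_, path_z⟩
  exact (SimpleGraph.Walk.concat_inj (congrArg Subtype.val path_eq)).1

theorem mem_children_or_mem_children (hG : G.IsTree) {x y : V} (h : G.Adj x y) :
    y ∈ children G o x ∨ x ∈ children G o y := by
  rw [mem_children, mem_children]
  rcases hG.dist_eq_dist_add_one_of_adj o h with hx | hy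
  · exact Or.inr ⟨h.symm, hx⟩
  · exact Or.inl ⟨h, hy⟩

theorem exists_mem_children (hG : G.IsTree) {x : V} (hx : x ≠ o) : ∃ y, x ∈ children G o y := by
  obtain ⟨p, hp⟩ := hG.connected.exists_walk_length_eq_dist x o
  cases p with
  | nil => exact absurd rfl hx
  | @cons _ y _ hadj q =>
    refine ⟨y, mem_children.2 ⟨hadj.symm, ?_⟩⟩
    have hq := SimpleGraph.dist_le q
    rw [SimpleGraph.Walk.length_cons, SimpleGraph.dist_comm] at hp
    rw [SimpleGraph.dist_comm] at hq
    rcases hG.dist_eq_dist_add_one_of_adj o hadj with h | h <;> omega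

theorem card_children_add_one (hG : G.IsTree) {x : V} (hx : x ≠ o) :
    (children G o x).card + 1 = G.degree x := by
  classical
  obtain ⟨p, hp⟩ := exists_mem_children hG hx
  have hp' := mem_children.1 hp
  have hnot : p ∉ children G o x := by
    rw [mem_children]
    omega
  rw [← SimpleGraph.card_neighborFinset_eq_degree, ← Finset.card_insert_of_notMem hnot]
  congr 1
  ext y
  rw [Finset.mem_insert, SimpleGraph.mem_neighborFinset]
  constructor
  · rintro (rfl | h)
    · exact hp'.1.symm
    · exact (mem_children.1 h).1
  · intro h
    exact (mem_children_or_mem_children (o := o) hG h).symm.imp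
      (fun h' => eq_of_mem_children hG h' hp) id

theorem children_nonempty [Infinite V] (hG : G.IsTree) (hleaf : ∀ v, G.degree v ≠ 1) (x : V) :
    (children G o x).Nonempty := by
  rw [← Finset.card_pos]
  have hpos : 0 < G.degree x := hG.connected.preconnected.degree_pos_of_nontrivial x
  rcases eq_or_ne x o with rfl | hx
  · rwa [card_children_root]
  · have := card_children_add_one hG hx
    have := hleaf x
    omega

theorem IsDescending.update {p : ℕ → V} {ℓ : ℕ} (hp : IsDescending G o p ℓ)
    {z : V} (hz : z ∈ children G o (p ℓ)) :
    IsDescending G o (Function.update p (ℓ + 1) z) (ℓ + 1) := by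
  refine ⟨by rw [Function.update_of_ne (by omega), hp.1], fun k hk => ?_⟩
  rw [Function.update_of_ne (a := k) (by omega)]
  rcases Nat.lt_succ_iff_lt_or_eq.1 hk with h | rfl
  · rw [Function.update_of_ne (by omega)]
    exact hp.2 k h
  · rwa [Function.update_self]

theorem IsDescending.exists_ray (hne : ∀ x, (children G o x).Nonempty) {p : ℕ → V} {ℓ : ℕ}
    (hp : IsDescending G o p ℓ) :
    ∃ q : ℕ → V, (∀ k ≤ ℓ, q k = p k) ∧ ∀ k, q (k + 1) ∈ children G o (q k) := by
  choose child hchild using hne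
  refine ⟨fun k => if k ≤ ℓ then p k else child^[k - ℓ] (p ℓ), fun k hk => if_pos hk, fun k => ?_⟩
  rcases lt_trichotomy k ℓ with h | rfl | h
  · simp only [if_pos h.le, if_pos (Nat.succ_le_of_lt h)]
    exact hp.2 k h
  · simp [hchild]
  · simp only [if_neg (show ¬ k ≤ ℓ by omega), if_neg (show ¬ k + 1 ≤ ℓ by omega)]
    rw [Nat.succ_sub h.le, Function.iterate_succ_apply']
    exact hchild _

theorem hasGrowth_of_forall_ray (hG : G.IsTree) (hne : ∀ x, (children G o x).Nonempty) {C μ : ℝ}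
    (hray : ∀ p : ℕ → V, p 0 = o → (∀ k, G.Adj (p k) (p (k + 1))) →
      (∀ k, G.dist o (p k) = k) →
      ∀ n : ℕ, C * μ ^ n ≤ ∏ k ∈ Finset.Icc 1 n, ((G.degree (p k) : ℝ) - 1) / 3) :
    HasGrowth G o C μ := by
  intro p ℓ hp
  obtain ⟨q, hqp, hq⟩ := hp.exists_ray hne
  have hq0 : q 0 = o := (hqp 0 ℓ.zero_le).trans hp.1
  have hdist (k : ℕ) : G.dist o (q k) = k := by
    induction k with
    | zero => simp [hq0]
    | succ k ih => rw [(mem_children.1 (hq k)).2, ih]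
  refine (hray q hq0 (fun k => (mem_children.1 (hq k)).1) hdist ℓ).trans_eq ?_
  refine Finset.prod_congr rfl fun k hk => ?_
  obtain ⟨hk1, hkℓ⟩ := Finset.mem_Icc.1 hk
  have hroot : q k ≠ o := fun h => by
    have := hdist k
    rw [h, SimpleGraph.dist_self] at this
    omega
  rw [← card_children_add_one hG hroot, hqp k hkℓ]
  push_cast
  ring

end Tree

/-! ### Messages -/

/-- `f` is, up to a positive factor, affine on `[0, 1]` with a relative slope in `(0, 1]` whose
inverse is at most `b`. -/
def IsTilted (b : ℝ) (f : ℝ → ℝ) : Prop :=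
  ∃ a β : ℝ, 0 < a ∧ 0 < β ∧ β ≤ 1 ∧ β⁻¹ ≤ b ∧ ∀ t, f t = a * (1 + β * (2 * t - 1))

/-- Integration of `Q` against the kernel `t s + (1 - t) (1 - s)` of a valence bond. -/
def transfer (Q : ℝ → ℝ) (t : ℝ) : ℝ :=
  t * (∫ s in (0 : ℝ)..1, s * Q s) + (1 - t) * ∫ s in (0 : ℝ)..1, (1 - s) * Q s

theorem IsTilted.mono {b b' : ℝ} {f : ℝ → ℝ} (hf : IsTilted b f) (h : b ≤ b') :
    IsTilted b' f := by
  obtain ⟨a, β, ha, hβ, hβ1, hb, hf⟩ := hf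
  exact ⟨a, β, ha, hβ, hβ1, hb.trans h, hf⟩

theorem continuous_transfer (Q : ℝ → ℝ) : Continuous (transfer Q) := by
  unfold transfer
  fun_prop

theorem transfer_eq {Q : ℝ → ℝ} (hQ : Continuous Q) (t : ℝ) :
    transfer Q t = ((∫ s in (0 : ℝ)..1, Q s)
      + (2 * t - 1) * ∫ s in (0 : ℝ)..1, (2 * s - 1) * Q s) / 2 := by
  have hQi := hQ.intervalIntegrable (μ := MeasureTheory.volume) 0 1
  have hsQi : IntervalIntegrable (fun s => s * Q s) MeasureTheory.volume 0 1 :=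
    (continuous_id'.mul hQ).intervalIntegrable 0 1
  have first : ∫ s in (0 : ℝ)..1, (1 - s) * Q s =
      (∫ s in (0 : ℝ)..1, Q s) - ∫ s in (0 : ℝ)..1, s * Q s := by
    rw [← intervalIntegral.integral_sub hQi hsQi]
    simp only [one_sub_mul]
  have second : ∫ s in (0 : ℝ)..1, (2 * s - 1) * Q s =
      2 * (∫ s in (0 : ℝ)..1, s * Q s) - ∫ s in (0 : ℝ)..1, Q s := by
    rw [← intervalIntegral.integral_const_mul, ← intervalIntegral.integral_sub
      (hsQi.const_mul 2) hQi]
    simp only [sub_one_mul, mul_assoc]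
  rw [transfer, first, second]
  ring

theorem isTilted_transfer {Q : ℝ → ℝ} (hQ : Continuous Q) {b : ℝ}
    (hpos : 0 < ∫ s in (0 : ℝ)..1, (2 * s - 1) * Q s)
    (hle : ∫ s in (0 : ℝ)..1, (2 * s - 1) * Q s ≤ ∫ s in (0 : ℝ)..1, Q s)
    (hb : ∫ s in (0 : ℝ)..1, Q s ≤ b * ∫ s in (0 : ℝ)..1, (2 * s - 1) * Q s) :
    IsTilted b (transfer Q) := by
  have hQpos := hpos.trans_le hle
  refine ⟨(∫ s in (0 : ℝ)..1, Q s) / 2,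
    (∫ s in (0 : ℝ)..1, (2 * s - 1) * Q s) / ∫ s in (0 : ℝ)..1, Q s,
    half_pos hQpos, div_pos hpos hQpos, (div_le_one hQpos).2 hle, ?_, fun t => ?_⟩
  · rwa [inv_div, div_le_iff₀ hpos]
  · rw [transfer_eq hQ]
    field_simp

section Recursion

variable {ι : Type*} {I : Finset ι}

theorem integral_prod_le_of_inv_le (hI : I.Nonempty) {β : ι → ℝ} {b : ℝ}
    (h0 : ∀ i ∈ I, 0 < β i) (h1 : ∀ i ∈ I, β i ≤ 1) (hb : ∀ i ∈ I, (β i)⁻¹ ≤ b) :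
    0 < (∫ t in (0 : ℝ)..1, (2 * t - 1) * ∏ i ∈ I, (1 + β i * (2 * t - 1))) ∧
    (∫ t in (0 : ℝ)..1, ∏ i ∈ I, (1 + β i * (2 * t - 1))) ≤
      (3 + 3 * b / I.card) * ∫ t in (0 : ℝ)..1, (2 * t - 1) * ∏ i ∈ I, (1 + β i * (2 * t - 1)) := by
  have hD := integral_prod_pos (fun i hi => (h0 i hi).le) h1
  have hlow := sum_mul_integral_prod_le (fun i hi => (h0 i hi).le) h1
  set D := ∫ t in (0 : ℝ)..1, ∏ i ∈ I, (1 + β i * (2 * t - 1))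
  set N := ∫ t in (0 : ℝ)..1, (2 * t - 1) * ∏ i ∈ I, (1 + β i * (2 * t - 1))
  set S := ∑ i ∈ I, β i
  have hcard : (0 : ℝ) < I.card := by exact_mod_cast hI.card_pos
  have hb0 : 0 < b := by
    obtain ⟨i, hi⟩ := hI
    exact (inv_pos.2 (h0 i hi)).trans_le (hb i hi)
  have hS : (I.card : ℝ) / b ≤ S := by
    rw [div_eq_mul_inv, ← nsmul_eq_mul]
    exact Finset.card_nsmul_le_sum _ _ _ fun i hi => inv_le_of_inv_le₀ (h0 i hi) (hb i hi)
  have hS0 : 0 < S := (div_pos hcard hb0).trans_le hS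
  have hN : 0 < N := pos_of_mul_pos_right ((mul_pos hS0 hD).trans_le hlow) (by positivity)
  refine ⟨hN, ?_⟩
  calc D ≤ 3 * (1 + S) * N / S := by rwa [le_div_iff₀' hS0]
    _ = (3 + 3 * S⁻¹) * N := by field_simp; ring
    _ ≤ (3 + 3 * (b / I.card)) * N := by
        gcongr
        rw [← inv_div]
        exact inv_anti₀ (div_pos hcard hb0) hS
    _ = (3 + 3 * b / I.card) * N := by ring

theorem IsTilted.exists_prod_eq {f : ι → ℝ → ℝ} {b : ℝ} (hf : ∀ i ∈ I, IsTilted b (f i)) :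
    ∃ (a : ℝ) (β : ι → ℝ), 0 < a ∧ (∀ i ∈ I, 0 < β i) ∧ (∀ i ∈ I, β i ≤ 1) ∧
      (∀ i ∈ I, (β i)⁻¹ ≤ b) ∧
      ∀ t, ∏ i ∈ I, f i t = a * ∏ i ∈ I, (1 + β i * (2 * t - 1)) := by
  choose! a β ha hβ hβ1 hb hf using hf
  refine ⟨∏ i ∈ I, a i, β, Finset.prod_pos ha, hβ, hβ1, hb, fun t => ?_⟩
  rw [← Finset.prod_mul_distrib]
  exact Finset.prod_congr rfl fun i hi => hf i hi t

theorem IsTilted.integral_prod_le (hI : I.Nonempty) {f : ι → ℝ → ℝ} {b : ℝ}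
    (hf : ∀ i ∈ I, IsTilted b (f i)) :
    0 < (∫ t in (0 : ℝ)..1, (2 * t - 1) * ∏ i ∈ I, f i t) ∧
    (∫ t in (0 : ℝ)..1, (2 * t - 1) * ∏ i ∈ I, f i t) ≤ (∫ t in (0 : ℝ)..1, ∏ i ∈ I, f i t) ∧
    (∫ t in (0 : ℝ)..1, ∏ i ∈ I, f i t) ≤
      (3 + 3 * b / I.card) * ∫ t in (0 : ℝ)..1, (2 * t - 1) * ∏ i ∈ I, f i t := by
  obtain ⟨a, β, ha, hβ, hβ1, hb, hprod⟩ := IsTilted.exists_prod_eq hf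
  obtain ⟨hpos, hlow⟩ := integral_prod_le_of_inv_le hI hβ hβ1 hb
  have hle := integral_mul_prod_le (fun i hi => (hβ i hi).le) hβ1
  simp only [hprod, mul_left_comm _ a, intervalIntegral.integral_const_mul]
  exact ⟨mul_pos ha hpos, mul_le_mul_of_nonneg_left hle ha.le,
    mul_le_mul_of_nonneg_left hlow ha.le⟩

end Recursion

section Message

variable {V : Type*} (G : SimpleGraph V) [G.LocallyFinite] (o : V)

/-- The message that the vertex `y` sends to its parent when the tree is cut `k` levels below
`y`: as a function of the variable `t` of the parent, the integral over the variables of the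
branch at `y`. -/
def message : ℕ → V → ℝ → ℝ
  | 0, _ => id
  | k + 1, y => transfer fun s => ∏ z ∈ children G o y, message k z s

/-- The bound of `isTilted_message` on the inverse slope of the messages received by the `ℓ`-th
vertex of the path `p`. It is chosen so that `3 + μ⁻¹ b ≤ b` for `b = slopeBound G o C μ p ℓ`. -/
def slopeBound (C μ : ℝ) (p : ℕ → V) (ℓ : ℕ) : ℝ :=
  3 / (C * (1 - μ⁻¹)) / μ ^ ℓ * ∏ j ∈ Finset.Icc 1 ℓ, ((children G o (p j)).card : ℝ) / 3

theorem continuous_message (k : ℕ) (y : V) : Continuous (message G o k y) := by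
  cases k with
  | zero => exact continuous_id
  | succ k => exact continuous_transfer _

variable {G o}

theorem three_le_slopeBound {C μ : ℝ} (hC : 0 < C) (hμ : 1 < μ) (hgrowth : HasGrowth G o C μ)
    {p : ℕ → V} {ℓ : ℕ} (hp : IsDescending G o p ℓ) :
    3 ≤ slopeBound G o C μ p ℓ * (1 - μ⁻¹) := by
  have : 0 < μ := one_pos.trans hμ
  have hr : 0 < 1 - μ⁻¹ := sub_pos.2 (inv_lt_one_of_one_lt₀ hμ)
  have := hgrowth p ℓ hp
  calc (3 : ℝ) = 3 / (C * (1 - μ⁻¹)) / μ ^ ℓ * (C * μ ^ ℓ) * (1 - μ⁻¹) := by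
        generalize 1 - μ⁻¹ = r at hr
        field_simp
    _ ≤ slopeBound G o C μ p ℓ * (1 - μ⁻¹) := by
        unfold slopeBound
        gcongr

theorem slopeBound_succ {C μ : ℝ} {p : ℕ → V} {ℓ : ℕ} (hμ : μ ≠ 0)
    (hne : (children G o (p (ℓ + 1))).Nonempty) :
    3 * slopeBound G o C μ p (ℓ + 1) / (children G o (p (ℓ + 1))).card =
      slopeBound G o C μ p ℓ * μ⁻¹ := by
  have hcard : ((children G o (p (ℓ + 1))).card : ℝ) ≠ 0 := by exact_mod_cast hne.card_pos.ne'
  rw [slopeBound, slopeBound, Finset.prod_Icc_succ_top (by omega)]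
  generalize 3 / (C * (1 - μ⁻¹)) = K
  generalize ((children G o (p (ℓ + 1))).card : ℝ) = m at *
  generalize ∏ j ∈ Finset.Icc 1 ℓ, ((children G o (p j)).card : ℝ) / 3 = P
  field_simp
  ring

theorem isTilted_message (hne : ∀ x, (children G o x).Nonempty) {C μ : ℝ} (hC : 0 < C)
    (hμ : 1 < μ) (hgrowth : HasGrowth G o C μ) (k : ℕ) {p : ℕ → V} {ℓ : ℕ}
    (hp : IsDescending G o p ℓ) {z : V} (hz : z ∈ children G o (p ℓ)) :
    IsTilted (slopeBound G o C μ p ℓ) (message G o k z) := by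
  classical
  have three_le := three_le_slopeBound hC hμ hgrowth hp
  induction k generalizing p ℓ z with
  | zero =>
    refine ⟨1 / 2, 1, by norm_num, one_pos, le_rfl, ?_, fun t => by simp [message]⟩
    have hμ_inv : 0 < μ⁻¹ := inv_pos.2 (one_pos.trans hμ)
    nlinarith [inv_lt_one_of_one_lt₀ hμ]
  | succ k ih =>
    set q := Function.update p (ℓ + 1) z with hq_def
    have hq : IsDescending G o q (ℓ + 1) := hp.update hz
    have hqz : q (ℓ + 1) = z := Function.update_self ..
    have bound_eq : slopeBound G o C μ q ℓ = slopeBound G o C μ p ℓ := by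
      unfold slopeBound
      congr 1
      refine Finset.prod_congr rfl fun j hj => ?_
      rw [hq_def, Function.update_of_ne]
      have := (Finset.mem_Icc.1 hj).2
      omega
    obtain ⟨hpos, hle, hb⟩ := IsTilted.integral_prod_le (hne z) fun w hw =>
      ih hq (hqz ▸ hw) (three_le_slopeBound hC hμ hgrowth hq)
    refine (isTilted_transfer (continuous_finsetProd _ fun w _ => continuous_message G o k w)
      hpos hle hb).mono ?_
    have := slopeBound_succ (C := C) (p := q) (one_pos.trans hμ).ne' (hqz ▸ hne z)
    rw [hqz, bound_eq] at this
    linarith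

end Message

/-! ### Partition functions -/

section Partition

variable {V : Type*} [DecidableEq V] (G : SimpleGraph V) [G.LocallyFinite] (o : V)

/-- The finite set `B` contains the root and the parents of its vertices. -/
structure IsRootedSubtree (B : Finset V) : Prop where
  root_mem : o ∈ B
  parent_mem : ∀ {x p}, x ∈ B → x ∈ children G o p → p ∈ B

/-- The factor at one end of the edge above `y` when `S` is the set of the marked edges (an edge
is labelled by its lower end). -/
def edgeFactor (S : Finset V) (y : V) (t : ℝ) : ℝ :=
  if y ∈ S then t else 1 - t

/-- The integral over the variable of the vertex `x`, with the factor `u x` from above and the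
factors `g y` of the children `y`. -/
def vertexWeight (u g : V → ℝ → ℝ) (x : V) : ℝ :=
  ∫ t in (0 : ℝ)..1, u x t * ∏ y ∈ children G o x, g y t

/-- The product of the weights of the vertices of `B`. The edge above `y` carries `e y` at both
ends when `y ∈ B`, the root has the factor `φ` instead of an edge above it, and a vertex `y ∉ B`
sends the message `msg y` to its parent. -/
def regionWeight (B : Finset V) (φ : ℝ → ℝ) (e msg : V → ℝ → ℝ) : ℝ :=
  ∏ x ∈ B, vertexWeight G o (Function.update e o φ) (B.piecewise e msg) x

/-- The sum of the weights of the region `B` over the sets of marked edges. -/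
def partitionFunction (B : Finset V) (φ : ℝ → ℝ) (msg : V → ℝ → ℝ) : ℝ :=
  ∑ S ∈ (B.erase o).powerset, regionWeight G o B φ (edgeFactor S) msg

variable {G o} {B : Finset V}

theorem IsRootedSubtree.induction {P : Finset V → Prop} (hG : G.IsTree) (root : P {o})
    (insert : ∀ (B : Finset V) (x p : V), IsRootedSubtree G o B → x ∉ B → p ∈ B →
      x ∈ children G o p → Disjoint (children G o x) B → P B → P (insert x B))
    (hB : IsRootedSubtree G o B) : P B := by
  induction B using Finset.strongInduction with
  | H B ih =>
    rcases (B.erase o).eq_empty_or_nonempty with h_empty | h_nonempty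
    · rwa [← Finset.insert_erase hB.root_mem, h_empty, insert_empty_eq]
    obtain ⟨x, hx, hmax⟩ := Finset.exists_max_image _ (G.dist o) h_nonempty
    obtain ⟨hxo, hxB⟩ := Finset.mem_erase.1 hx
    obtain ⟨p, hxp⟩ := exists_mem_children hG hxo
    have hpx : p ≠ x := fun h => G.irrefl (h ▸ (mem_children.1 hxp).1)
    have leaf {y : V} (hy : y ∈ children G o x) : y ∉ B := fun hyB => by
      have := hmax y (Finset.mem_erase.2 ⟨ne_root_of_mem_children hy, hyB⟩)
      rw [(mem_children.1 hy).2] at this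
      omega
    have hB' : IsRootedSubtree G o (B.erase x) :=
      ⟨Finset.mem_erase.2 ⟨hxo.symm, hB.root_mem⟩, fun {y q} hy hyq =>
        Finset.mem_erase.2 ⟨fun h => leaf (h ▸ hyq) (Finset.mem_of_mem_erase hy),
          hB.parent_mem (Finset.mem_of_mem_erase hy) hyq⟩⟩
    rw [← Finset.insert_erase hxB]
    exact insert _ x p hB' (Finset.notMem_erase x B)
      (Finset.mem_erase.2 ⟨hpx, hB.parent_mem hxB hxp⟩) hxp
      (Finset.disjoint_left.2 fun y hy hyB => leaf hy (Finset.mem_of_mem_erase hyB))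
      (ih _ (Finset.erase_ssubset hxB) hB')

theorem isRootedSubtree_ball (hG : G.Connected) (n : ℕ) : IsRootedSubtree G o (ball G o n) where
  root_mem := by simp [mem_ball G hG]
  parent_mem {x p} hx hxp := by
    rw [mem_ball G hG] at hx ⊢
    rw [(mem_children.1 hxp).2] at hx
    omega

theorem continuous_edgeFactor (S : Finset V) (y : V) : Continuous (edgeFactor S y) := by
  unfold edgeFactor
  split_ifs <;> fun_prop

theorem edgeFactor_insert (S : Finset V) (x : V) :
    edgeFactor (insert x S) = Function.update (edgeFactor S) x id := by
  funext y t
  rcases eq_or_ne y x with rfl | h <;> simp [edgeFactor, *]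

theorem edgeFactor_eq_update {S : Finset V} {x : V} (hx : x ∉ S) :
    edgeFactor S = Function.update (edgeFactor S) x (1 - ·) := by
  rw [eq_comm, Function.update_eq_self_iff]
  funext t
  simp [edgeFactor, hx]

omit [DecidableEq V] in
theorem vertexWeight_congr {u u' g g' : V → ℝ → ℝ} {x : V} (hu : u x = u' x)
    (hg : ∀ y ∈ children G o x, g y = g' y) :
    vertexWeight G o u g x = vertexWeight G o u' g' x := by
  simp only [vertexWeight, hu]
  congr! 3 with t
  exact Finset.prod_congr rfl fun y hy => by rw [hg y hy]

theorem regionWeight_insert {φ : ℝ → ℝ} {e msg : V → ℝ → ℝ} {x : V} (hxo : x ≠ o) (hxB : x ∉ B)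
    (hx : Disjoint (children G o x) B) (h : ℝ → ℝ) :
    regionWeight G o (insert x B) φ (Function.update e x h) msg =
      (∫ s in (0 : ℝ)..1, h s * ∏ z ∈ children G o x, msg z s) *
        regionWeight G o B φ e (Function.update msg x h) := by
  have hpiecewise : (insert x B).piecewise (Function.update e x h) msg =
      B.piecewise e (Function.update msg x h) := by
    rw [Finset.piecewise_insert, Function.update_self, Finset.update_piecewise_of_notMem _ _ _ hxB]
    exact Finset.piecewise_congr _
      (fun y hy => Function.update_of_ne (ne_of_mem_of_not_mem hy hxB) _ _) fun _ _ => rfl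
  rw [regionWeight, hpiecewise, Finset.prod_insert hxB, regionWeight]
  congr 1
  · rw [vertexWeight, Function.update_of_ne hxo, Function.update_self]
    congr! 3 with s
    refine Finset.prod_congr rfl fun z hz => ?_
    have hzx : z ≠ x := fun h => G.irrefl (h ▸ (mem_children.1 hz).1)
    rw [Finset.piecewise_eq_of_notMem _ _ _ (Finset.disjoint_left.1 hx hz),
      Function.update_of_ne hzx]
  · refine Finset.prod_congr rfl fun z hz => vertexWeight_congr ?_ fun _ _ => rfl
    rw [Function.update_comm hxo, Function.update_of_ne (ne_of_mem_of_not_mem hz hxB)]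

theorem exists_regionWeight_update_eq_integral (hG : G.IsTree) {φ : ℝ → ℝ} {e msg : V → ℝ → ℝ}
    (hφ : Continuous φ) (he : ∀ y, Continuous (e y)) (hmsg : ∀ y, Continuous (msg y)) {x p : V}
    (hxB : x ∉ B) (hpB : p ∈ B) (hxp : x ∈ children G o p) :
    ∃ R : ℝ → ℝ, Continuous R ∧ ∀ h : ℝ → ℝ,
      regionWeight G o B φ e (Function.update msg x h) = ∫ t in (0 : ℝ)..1, h t * R t := by
  set u := Function.update e o φ with hu_def
  set g := B.piecewise e msg with hg_def
  have hu : Continuous (u p) := by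
    rw [hu_def, Function.update_apply]
    split_ifs
    exacts [hφ, he p]
  have hg (y : V) : Continuous (g y) := by
    by_cases hy : y ∈ B <;> simp [hg_def, hy, he, hmsg]
  refine ⟨fun t => (∏ z ∈ B.erase p, vertexWeight G o u g z) *
    (u p t * ∏ y ∈ (children G o p).erase x, g y t), ?_, fun h => ?_⟩
  · exact continuous_const.mul (hu.mul (continuous_finsetProd _ fun y _ => hg y))
  rw [regionWeight, ← Finset.update_piecewise_of_notMem _ _ _ hxB, ← Finset.prod_erase_mul _ _ hpB]
  have away_from_parent : ∀ z ∈ B.erase p,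
      vertexWeight G o u (Function.update g x h) z = vertexWeight G o u g z := fun z hz =>
    vertexWeight_congr rfl fun y hy => Function.update_of_ne (fun hyx =>
      Finset.ne_of_mem_erase hz (eq_of_mem_children hG (hyx ▸ hy) hxp)) _ _
  rw [Finset.prod_congr rfl away_from_parent, vertexWeight,
    ← intervalIntegral.integral_const_mul]
  congr 1
  funext t
  have siblings : ∏ y ∈ (children G o p).erase x, Function.update g x h y t =
      ∏ y ∈ (children G o p).erase x, g y t := Finset.prod_congr rfl fun y hy => by
    rw [Function.update_of_ne (Finset.ne_of_mem_erase hy)]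
  rw [← Finset.mul_prod_erase _ _ hxp, Function.update_self, siblings]
  ring

theorem partitionFunction_insert (hG : G.IsTree) {φ : ℝ → ℝ} {msg : V → ℝ → ℝ}
    (hφ : Continuous φ) (hmsg : ∀ y, Continuous (msg y)) {x p : V} (hxB : x ∉ B) (hpB : p ∈ B)
    (hxp : x ∈ children G o p) (hx : Disjoint (children G o x) B)
    (hrec : msg x = transfer fun s => ∏ z ∈ children G o x, msg z s) :
    partitionFunction G o (insert x B) φ msg = partitionFunction G o B φ msg := by
  have hxo : x ≠ o := ne_root_of_mem_children hxp
  have hxBo : x ∉ B.erase o := fun h => hxB (Finset.mem_of_mem_erase h)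
  rw [partitionFunction, Finset.erase_insert_of_ne hxo, Finset.sum_powerset_insert hxBo,
    ← Finset.sum_add_distrib]
  refine Finset.sum_congr rfl fun S hS => ?_
  have hxS : x ∉ S := fun h => hxBo (Finset.mem_powerset.1 hS h)
  obtain ⟨R, hR, integral_R⟩ := exists_regionWeight_update_eq_integral hG hφ
    (continuous_edgeFactor S) hmsg hxB hpB hxp
  have unmarked := regionWeight_insert (φ := φ) (e := edgeFactor S) (msg := msg) hxo hxB hx (1 - ·)
  have marked := regionWeight_insert (φ := φ) (e := edgeFactor S) (msg := msg) hxo hxB hx id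
  rw [← edgeFactor_eq_update hxS, integral_R] at unmarked
  rw [← edgeFactor_insert, integral_R] at marked
  rw [unmarked, marked, ← Function.update_eq_self x msg, integral_R, Function.update_eq_self, hrec,
    ← intervalIntegral.integral_const_mul, ← intervalIntegral.integral_const_mul,
    ← intervalIntegral.integral_add
      (Continuous.intervalIntegrable (by fun_prop) _ _)
      (Continuous.intervalIntegrable (by fun_prop) _ _)]
  congr! 2
  simp only [transfer, id]
  ring

theorem partitionFunction_eq_integral (hG : G.IsTree) {φ : ℝ → ℝ} {msg : V → ℝ → ℝ}
    (hφ : Continuous φ) (hmsg : ∀ y, Continuous (msg y)) (hB : IsRootedSubtree G o B)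
    (hrec : ∀ x ∈ B.erase o, msg x = transfer fun s => ∏ z ∈ children G o x, msg z s) :
    partitionFunction G o B φ msg = ∫ t in (0 : ℝ)..1, φ t * ∏ y ∈ children G o o, msg y t := by
  refine IsRootedSubtree.induction (P := fun B =>
    (∀ x ∈ B.erase o, msg x = transfer fun s => ∏ z ∈ children G o x, msg z s) →
      partitionFunction G o B φ msg = ∫ t in (0 : ℝ)..1, φ t * ∏ y ∈ children G o o, msg y t)
    hG (fun _ => ?_) (fun B x p _ hxB hpB hxp hx ih hrec => ?_) hB hrec
  · rw [partitionFunction, Finset.erase_singleton, Finset.powerset_empty, Finset.sum_singleton,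
      regionWeight, Finset.prod_singleton]
    refine vertexWeight_congr (u' := fun _ => φ) (g' := msg) (Function.update_self ..)
      fun y hy => ?_
    exact Finset.piecewise_eq_of_notMem _ _ _
      (Finset.notMem_singleton.2 (ne_root_of_mem_children hy))
  · have hx_mem : x ∈ (insert x B).erase o :=
      Finset.mem_erase.2 ⟨ne_root_of_mem_children hxp, Finset.mem_insert_self x B⟩
    rw [partitionFunction_insert hG hφ hmsg hxB hpB hxp hx (hrec x hx_mem)]
    exact ih fun y hy => hrec y (Finset.erase_subset_erase o (Finset.subset_insert x B) hy)

end Partition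

/-! ### Valence bonds in the occupation number basis -/

section Occupation

variable {V : Type*} {d : V → ℕ} {Λ : Finset V}

/-- The configuration with `k x` bosons at the site `x`, of the first kind where `c x` holds and of
the second kind elsewhere. It is meaningful only if `k x ≤ d x` on `Λ`. -/
def bosonConf (d : V → ℕ) (Λ : Finset V) (c : V → Bool) (k : V → ℕ) : Conf d Λ :=
  fun x => if c x then Fin.ofNat (d x + 1) (k x) else (Fin.ofNat (d x + 1) (k x)).rev

/-- The amplitude of the configurations with `k x` bosons of a given kind at `x` in the valence
bond states. -/
def occAmplitude (d : V → ℕ) (Λ : Finset V) (k : V → ℕ) : ℝ :=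
  ∏ x ∈ Λ, √(occWeight (d x) (k x))

/-- The basis vector of `bosonConf d Λ c k` with the amplitude `occAmplitude d Λ k`. -/
def occVec (d : V → ℕ) (Λ : Finset V) (c : V → Bool) (k : V → ℕ) : Conf d Λ → ℂ :=
  ((occAmplitude d Λ k : ℝ) : ℂ) • Pi.single (bosonConf d Λ c k) 1

theorem bosonConf_apply_of_true {c : V → Bool} {k : V → ℕ} {x : Λ} (hc : c x = true)
    (hk : k x ≤ d x) : (bosonConf d Λ c k x : ℕ) = k x := by
  rw [bosonConf, if_pos hc, Fin.val_ofNat, Nat.mod_eq_of_lt (Nat.lt_succ_of_le hk)]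

theorem bosonConf_apply_of_false {c : V → Bool} {k : V → ℕ} {x : Λ} (hc : c x = false)
    (hk : k x ≤ d x) : (bosonConf d Λ c k x : ℕ) = d x - k x := by
  rw [bosonConf, if_neg (by simp [hc]), Fin.val_rev, Fin.val_ofNat,
    Nat.mod_eq_of_lt (Nat.lt_succ_of_le hk), Nat.add_sub_add_right]

theorem eq_of_bosonConf_eq {c : V → Bool} {k k' : V → ℕ} {x : Λ} (hk : k x ≤ d x)
    (hk' : k' x ≤ d x) (h : bosonConf d Λ c k x = bosonConf d Λ c k' x) : k x = k' x := by
  rw [Fin.ext_iff] at h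
  cases hc : c x
  · rw [bosonConf_apply_of_false hc hk, bosonConf_apply_of_false hc hk'] at h
    omega
  · rwa [bosonConf_apply_of_true hc hk, bosonConf_apply_of_true hc hk'] at h

variable [DecidableEq V]

theorem bosonConf_add_single (c : V → Bool) (k : V → ℕ) (x : Λ) :
    bosonConf d Λ c (k + Pi.single (x : V) 1) =
      Function.update (bosonConf d Λ c k) x (bosonConf d Λ c (k + Pi.single (x : V) 1) x) := by
  rw [Function.eq_update_iff]
  refine ⟨rfl, fun y hy => ?_⟩
  simp [bosonConf, Subtype.coe_ne_coe.2 hy]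

theorem onSite_mulVec_single (x : Λ) (M : Matrix (Fin (d x + 1)) (Fin (d x + 1)) ℂ)
    (τ : Conf d Λ) : onSite x M *ᵥ Pi.single τ 1 =
      ∑ j, M j (τ x) • Pi.single (Function.update τ x j) (1 : ℂ) := by
  ext σ
  simp [onSite, Pi.single_apply, Function.eq_update_iff, ite_and]

theorem siteHom_createSecond_mulVec_single (x : Λ) (τ : Conf d Λ) :
    siteHom x (createSecond (d x)) *ᵥ Pi.single τ 1 =
      ((√((d x : ℝ) - (τ x : ℕ)) : ℝ) : ℂ) • Pi.single τ 1 := by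
  rw [siteHom_apply, onSite_mulVec_single, Finset.sum_eq_single (τ x)]
  · rw [Function.update_eq_self, createSecond, Matrix.diagonal_apply_eq]
  · intro j _ hj
    rw [createSecond, Matrix.diagonal_apply_ne _ hj, zero_smul]
  · simp

theorem siteHom_createFirst_mulVec_single (x : Λ) (τ : Conf d Λ) {j : Fin (d x + 1)}
    (hj : (j : ℕ) = τ x + 1) :
    siteHom x (createFirst (d x)) *ᵥ Pi.single τ 1 =
      ((√((τ x : ℕ) + 1) : ℝ) : ℂ) • Pi.single (Function.update τ x j) 1 := by
  rw [siteHom_apply, onSite_mulVec_single, Finset.sum_eq_single j]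
  · simp [createFirst, lowerShift, hj]
  · intro i _ hi
    have : ¬ (i : ℕ) = τ x + 1 := fun h => hi (Fin.ext (h.trans hj.symm))
    simp [createFirst, lowerShift, this]
  · simp

theorem bond_mulVec_single_bosonConf {c : V → Bool} {k : V → ℕ} {u v : Λ} (hcu : c u = true)
    (hcv : c v = false) (hu : k u < d u) (hv : k v < d v) :
    bond d Λ u v *ᵥ Pi.single (bosonConf d Λ c (k + Pi.single (v : V) 1)) 1 =
      ((√((k u : ℝ) + 1) * √((k v : ℝ) + 1) : ℝ) : ℂ) •
          Pi.single (bosonConf d Λ c (k + Pi.single (u : V) 1 + Pi.single (v : V) 1)) 1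
        - ((√((d u : ℝ) - k u) * √((d v : ℝ) - k v) : ℝ) : ℂ) •
          Pi.single (bosonConf d Λ c k) 1 := by
  have huv : (u : V) ≠ v := fun h => by simp [h, hcv] at hcu
  set τ := bosonConf d Λ c (k + Pi.single (v : V) 1) with hτ
  have τ_u : (τ u : ℕ) = k u := by
    rw [hτ, bosonConf_apply_of_true hcu] <;> simp [huv, hu.le]
  have τ_v : (τ v : ℕ) = d v - (k v + 1) := by
    rw [hτ, bosonConf_apply_of_false hcv] <;> simp [Nat.succ_le_of_lt hv]
  have k_v : (bosonConf d Λ c k v : ℕ) = d v - k v := bosonConf_apply_of_false hcv hv.le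
  have k_u : (bosonConf d Λ c k u : ℕ) = k u := bosonConf_apply_of_true hcu hu.le
  have raise_u : Function.update τ u
      (bosonConf d Λ c (k + Pi.single (v : V) 1 + Pi.single (u : V) 1) u) =
        bosonConf d Λ c (k + Pi.single (u : V) 1 + Pi.single (v : V) 1) := by
    rw [hτ, ← bosonConf_add_single, add_right_comm]
  have raise_v : Function.update τ v (bosonConf d Λ c k v) = bosonConf d Λ c k := by
    rw [hτ, bosonConf_add_single, Function.update_idem, Function.update_eq_self]
  rw [bond, Matrix.sub_mulVec, ← Matrix.mulVec_mulVec, ← Matrix.mulVec_mulVec,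
    siteHom_createSecond_mulVec_single,
    siteHom_createFirst_mulVec_single v τ (j := bosonConf d Λ c k v) (by omega), raise_v,
    Matrix.mulVec_smul, Matrix.mulVec_smul, siteHom_createSecond_mulVec_single,
    siteHom_createFirst_mulVec_single u τ
      (j := bosonConf d Λ c (k + Pi.single (v : V) 1 + Pi.single (u : V) 1) u)
      (by rw [τ_u, bosonConf_apply_of_true hcu] <;> simp [huv, Nat.succ_le_of_lt hu]), raise_u,
    smul_smul, smul_smul, τ_u, τ_v, k_u, Nat.cast_sub (Nat.succ_le_of_lt hv)]
  have second_v : (d v : ℝ) - ((d v : ℝ) - ((k v + 1 : ℕ) : ℝ)) = k v + 1 := by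
    push_cast
    ring
  have first_v : (d v : ℝ) - ((k v + 1 : ℕ) : ℝ) + 1 = d v - k v := by
    push_cast
    ring
  rw [second_v, first_v]
  push_cast
  congr 2 <;> ring

theorem occAmplitude_add_single {k : V → ℕ} {x : V} (hx : x ∈ Λ) (hk : k x < d x) :
    √((d x : ℝ) - k x) * occAmplitude d Λ (k + Pi.single x 1) =
      √((k x : ℝ) + 1) * occAmplitude d Λ k := by
  have hsub : (0 : ℝ) ≤ d x - k x := sub_nonneg.2 (by exact_mod_cast hk.le)
  have others : ∏ y ∈ Λ.erase x, √(occWeight (d y) ((k + Pi.single x 1 : V → ℕ) y)) =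
      ∏ y ∈ Λ.erase x, √(occWeight (d y) (k y)) := Finset.prod_congr rfl fun y hy => by
    rw [Pi.add_apply, Pi.single_eq_of_ne (Finset.ne_of_mem_erase hy), add_zero]
  rw [occAmplitude, occAmplitude, ← Finset.mul_prod_erase _ _ hx, ← Finset.mul_prod_erase _ _ hx,
    others, ← mul_assoc, ← mul_assoc, Pi.add_apply, Pi.single_eq_same,
    ← Real.sqrt_mul hsub, ← Real.sqrt_mul (by positivity), occWeight_succ hk]

theorem occVec_sub_mem_range_bond_of_color {c : V → Bool} {k : V → ℕ} {u v : Λ}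
    (hcu : c u = true) (hcv : c v = false) (hu : k u < d u) (hv : k v < d v) :
    occVec d Λ c k - occVec d Λ c (k + Pi.single (u : V) 1 + Pi.single (v : V) 1) ∈
      LinearMap.range (bond d Λ u v).mulVecLin := by
  have hvu : (v : V) ≠ u := fun h => by simp [h, hcu] at hcv
  set k' := k + Pi.single (u : V) 1 + Pi.single (v : V) 1 with hk'
  have ru : 0 < √((d u : ℝ) - k u) := Real.sqrt_pos.2 (sub_pos.2 (by exact_mod_cast hu))
  have rv : 0 < √((d v : ℝ) - k v) := Real.sqrt_pos.2 (sub_pos.2 (by exact_mod_cast hv))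
  set r := √((d u : ℝ) - k u) * √((d v : ℝ) - k v) with hr
  set q := √((k u : ℝ) + 1) * √((k v : ℝ) + 1) with hq
  have hr0 : (r : ℂ) ≠ 0 := Complex.ofReal_ne_zero.2 (mul_pos ru rv).ne'
  have amplitude_eq : (r : ℂ) * occAmplitude d Λ k' = q * occAmplitude d Λ k := by
    have step_u := occAmplitude_add_single u.2 hu
    have step_v := occAmplitude_add_single (k := k + Pi.single (u : V) 1) v.2
      (by simpa [hvu] using hv)
    simp only [Pi.add_apply, Pi.single_eq_of_ne hvu, add_zero] at step_v
    norm_cast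
    rw [hr, hq, mul_assoc, step_v, mul_left_comm, step_u]
    ring
  refine ⟨(-(occAmplitude d Λ k / r : ℂ)) •
    Pi.single (bosonConf d Λ c (k + Pi.single (v : V) 1)) 1, ?_⟩
  rw [map_smul, Matrix.mulVecLin_apply, bond_mulVec_single_bosonConf hcu hcv hu hv, occVec, occVec,
    smul_sub, smul_smul, smul_smul, ← hr, ← hq, ← hk', neg_mul, neg_mul, div_mul_cancel₀ _ hr0,
    div_mul_eq_mul_div, mul_comm _ (q : ℂ), ← amplitude_eq, mul_div_cancel_left₀ _ hr0, neg_smul,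
    neg_smul, neg_sub_neg]

theorem range_bond_swap {x y : Λ} (h : x ≠ y) :
    LinearMap.range (bond d Λ y x).mulVecLin = LinearMap.range (bond d Λ x y).mulVecLin := by
  have : (bond d Λ y x).mulVecLin = -(bond d Λ x y).mulVecLin := by
    rw [bond_swap h]
    ext1 χ
    simp
  rw [this, LinearMap.range_neg]

theorem occVec_sub_mem_range_bond {c : V → Bool} {k : V → ℕ} {u v : Λ} (hc : c u = !c v)
    (hu : k u < d u) (hv : k v < d v) :
    occVec d Λ c k - occVec d Λ c (k + Pi.single (u : V) 1 + Pi.single (v : V) 1) ∈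
      LinearMap.range (bond d Λ u v).mulVecLin := by
  have huv : u ≠ v := fun h => by simp [h] at hc
  cases hcv : c v with
  | false => exact occVec_sub_mem_range_bond_of_color (by simpa [hcv] using hc) hcv hu hv
  | true =>
    rw [range_bond_swap huv.symm, add_right_comm]
    exact occVec_sub_mem_range_bond_of_color hcv (by simpa [hcv] using hc) hv hu

end Occupation

/-! ### Valence bond states -/

section BondState

variable {V : Type*} [DecidableEq V] (G : SimpleGraph V) [G.LocallyFinite] (o : V)

/-- The number of marked edges at `x` when `S` is the set of the lower ends of the marked edges
inside `B` and all the edges that leave `B` downwards are marked. -/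
def count (B S : Finset V) (x : V) : ℕ :=
  (if x ∈ S then 1 else 0) + #{y ∈ children G o x | y ∈ B → y ∈ S}

/-- The weight of the set `S` of marked edges in the valence bond states of the tree `B`. -/
def markingWeight (B S : Finset V) : ℝ :=
  ∏ x ∈ B, occWeight (G.degree x) (count G o B S x)

/-- The valence bond state of the tree `B` with a polarized boundary. It expands the product of
the bonds `a_x† b_y† - b_x† a_y†`: a set `S` of marked edges selects one of the two terms of every
bond. For a 2-colouring `c` the marks at `x` are bosons of the first kind if `c x` holds and of the
second kind otherwise; passing from `c` to `!c` reverses the boundary spins. -/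
def bondState (B : Finset V) (c : V → Bool) : Conf (fun v => G.degree v) B → ℂ :=
  ∑ S ∈ (B.erase o).powerset, (-1 : ℂ) ^ #S • occVec (fun v => G.degree v) B c (count G o B S)

variable {G o} {B S : Finset V}

theorem count_le_degree (hG : G.IsTree) (hS : o ∉ S) (x : V) : count G o B S x ≤ G.degree x := by
  have filter_le := Finset.card_filter_le (children G o x) fun y => y ∈ B → y ∈ S
  rw [count]
  rcases eq_or_ne x o with rfl | hx
  · rwa [if_neg hS, zero_add, ← card_children_root]
  · rw [← card_children_add_one hG hx]
    split_ifs <;> omega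

theorem count_insert (hG : G.IsTree) {x p : V} (hxS : x ∉ S) (hxB : x ∈ B)
    (hxp : x ∈ children G o p) :
    count G o B (insert x S) = count G o B S + Pi.single x 1 + Pi.single p 1 := by
  have marked_children (z : V) : #{y ∈ children G o z | y ∈ B → y ∈ insert x S} =
      #{y ∈ children G o z | y ∈ B → y ∈ S} + (Pi.single p 1 : V → ℕ) z := by
    rcases eq_or_ne z p with rfl | hz
    · have : {y ∈ children G o z | y ∈ B → y ∈ insert x S} =
          insert x {y ∈ children G o z | y ∈ B → y ∈ S} := by
        ext y
        rcases eq_or_ne y x with rfl | hy <;> simp [*]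
      rw [this, Finset.card_insert_of_notMem (by simp [hxS, hxB]), Pi.single_eq_same]
    · rw [Pi.single_eq_of_ne hz, add_zero]
      congr 1
      refine Finset.filter_congr fun y hy => ?_
      rw [Finset.mem_insert, or_iff_right]
      rintro rfl
      exact hz (eq_of_mem_children hG hy hxp)
  funext z
  rw [Pi.add_apply, Pi.add_apply, count, count, marked_children]
  rcases eq_or_ne z x with rfl | hz
  · simp [hxS]
    ring
  · simp [hz, add_assoc]

theorem bondState_mem_range_bond (hG : G.IsTree) {c : V → Bool} (x p : B)
    (hxp : (x : V) ∈ children G o p) (hc : c x = !c p) :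
    bondState G o B c ∈ LinearMap.range (bond (fun v => G.degree v) B x p).mulVecLin := by
  have hxo : (x : V) ≠ o := ne_root_of_mem_children hxp
  have hxp_ne : (x : V) ≠ p := (mem_children.1 hxp).1.ne'
  rw [bondState, ← Finset.insert_erase (Finset.mem_erase.2 ⟨hxo, x.2⟩),
    Finset.sum_powerset_insert (Finset.notMem_erase _ _), ← Finset.sum_add_distrib]
  refine Submodule.sum_mem _ fun S hS => ?_
  rw [Finset.mem_powerset] at hS
  have hxS : (x : V) ∉ S := fun h => Finset.notMem_erase _ _ (hS h)
  have ho : o ∉ insert (x : V) S := by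
    rw [Finset.mem_insert, not_or]
    exact ⟨hxo.symm, fun h => Finset.notMem_erase o B (Finset.mem_of_mem_erase (hS h))⟩
  have count_eq := count_insert hG hxS x.2 hxp
  have hx_le := count_le_degree (B := B) hG ho x
  have hp_le := count_le_degree (B := B) hG ho p
  simp only [count_eq, Pi.add_apply, Pi.single_eq_same, Pi.single_eq_of_ne hxp_ne,
    Pi.single_eq_of_ne hxp_ne.symm, add_zero] at hx_le hp_le
  rw [Finset.card_insert_of_notMem hxS, count_eq, pow_succ, mul_neg_one, neg_smul, ← sub_eq_add_neg,
    ← smul_sub]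
  exact Submodule.smul_mem _ _ (occVec_sub_mem_range_bond hc hx_le hp_le)

theorem bondState_mem_bondedSpace (hG : G.IsTree) (B : Finset V) {c : V → Bool}
    (hc : ∀ x y, G.Adj x y → c x = !c y) : bondState G o B c ∈ bondedSpace G B := by
  simp only [bondedSpace, Submodule.mem_iInf]
  intro x y hxy
  rcases mem_children_or_mem_children (o := o) hG hxy with h | h
  · rw [← range_bond_swap (fun h => hxy.ne (congrArg Subtype.val h))]
    exact bondState_mem_range_bond hG y x h (hc y x hxy.symm)
  · exact bondState_mem_range_bond hG x y h (hc x y hxy)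

theorem eq_of_forall_count_eq {T : Finset V} (hS : S ⊆ B) (hT : T ⊆ B)
    (h : ∀ x ∈ B, count G o B S x = count G o B T x) : S = T := by
  rw [← symmDiff_eq_bot, Finset.bot_eq_empty, ← Finset.not_nonempty_iff_eq_empty]
  intro h_nonempty
  obtain ⟨x, hx, hmax⟩ := Finset.exists_max_image _ (G.dist o) h_nonempty
  have hxB : x ∈ B := (Finset.mem_symmDiff.1 hx).elim (fun h => hS h.1) fun h => hT h.1
  have same_below : {y ∈ children G o x | y ∈ B → y ∈ S} =
      {y ∈ children G o x | y ∈ B → y ∈ T} := by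
    refine Finset.filter_congr fun y hy => forall_congr' fun _ => ?_
    have : y ∉ symmDiff S T := fun hyST => by
      have := hmax y hyST
      rw [(mem_children.1 hy).2] at this
      omega
    rw [Finset.mem_symmDiff] at this
    tauto
  have := h x hxB
  rw [count, count, same_below] at this
  rcases Finset.mem_symmDiff.1 hx with ⟨hxS, hxT⟩ | ⟨hxT, hxS⟩ <;> simp [hxS, hxT] at this

theorem injOn_bosonConf_count (hG : G.IsTree) (c : V → Bool) :
    Set.InjOn (fun S => bosonConf (fun v => G.degree v) B c (count G o B S))
      (B.erase o).powerset := by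
  intro S hS T hT hST
  rw [Finset.mem_coe, Finset.mem_powerset, Finset.subset_erase] at hS hT
  exact eq_of_forall_count_eq hS.1 hT.1 fun x hx => eq_of_bosonConf_eq (x := ⟨x, hx⟩)
    (count_le_degree hG hS.2 x) (count_le_degree hG hT.2 x) (congrFun hST ⟨x, hx⟩)

theorem sum_apply_sum_smul_single {ι κ : Type*} [Fintype κ] [DecidableEq κ] {I : Finset ι}
    {g : ι → κ} (hg : Set.InjOn g I) (a : ι → ℂ) (F : κ → ℂ → ℂ) (hF : ∀ σ, F σ 0 = 0) :
    ∑ σ, F σ ((∑ i ∈ I, a i • Pi.single (g i) (1 : ℂ) : κ → ℂ) σ) = ∑ i ∈ I, F (g i) (a i) := by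
  have coeff (i : ι) (hi : i ∈ I) :
      (∑ j ∈ I, a j • Pi.single (g j) (1 : ℂ) : κ → ℂ) (g i) = a i := by
    rw [Finset.sum_apply, Finset.sum_eq_single_of_mem i hi fun j hj hji => ?_]
    · simp
    · have : g i ≠ g j := fun h => hji (hg hj hi h.symm)
      simp [this]
  classical
  rw [← Finset.sum_subset (Finset.subset_univ (I.image g)), Finset.sum_image hg]
  · exact Finset.sum_congr rfl fun i hi => by rw [coeff i hi]
  · intro σ _ hσ
    rw [Finset.sum_apply, Finset.sum_eq_zero, hF]
    intro i hi
    have : σ ≠ g i := fun h => hσ (h ▸ Finset.mem_image_of_mem g hi)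
    simp [this]

theorem sum_bondState (hG : G.IsTree) (B : Finset V) (c : V → Bool)
    (f : Conf (fun v => G.degree v) B → ℂ) :
    ∑ σ, bondState G o B c σ * star (bondState G o B c σ) * f σ =
      ∑ S ∈ (B.erase o).powerset, (markingWeight G o B S : ℂ) *
        f (bosonConf (fun v => G.degree v) B c (count G o B S)) := by
  simp only [bondState, occVec, smul_smul]
  rw [sum_apply_sum_smul_single (injOn_bosonConf_count hG c) _ (fun σ z => z * star z * f σ)
    fun σ => by simp]
  refine Finset.sum_congr rfl fun S _ => ?_
  congr 1
  rw [star_mul', star_pow, star_neg, star_one, mul_mul_mul_comm, ← mul_pow, neg_one_mul, neg_neg,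
    one_pow, one_mul, Complex.star_def, Complex.conj_ofReal, ← Complex.ofReal_mul, occAmplitude,
    markingWeight, ← Finset.prod_mul_distrib]
  congr! 3
  exact Real.mul_self_sqrt (occWeight_pos _ _).le

end BondState

/-! ### The magnetization at the root -/

section Magnetization

variable {V : Type*} [DecidableEq V] (G : SimpleGraph V) [G.LocallyFinite] (o : V)

/-- The expectation of the third spin component at the root in the valence bond state of `B` in
which the marks at the root are bosons of the first kind. -/
def rootMagnetization (B : Finset V) : ℝ :=
  (∑ S ∈ (B.erase o).powerset,
      markingWeight G o B S * ((count G o B S o : ℝ) - (G.degree o : ℝ) / 2)) /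
    ∑ S ∈ (B.erase o).powerset, markingWeight G o B S

variable {G o} {B S : Finset V} {msg : V → ℝ → ℝ}

theorem sum_markingWeight_pos : 0 < ∑ S ∈ (B.erase o).powerset, markingWeight G o B S :=
  Finset.sum_pos (fun _ _ => Finset.prod_pos fun _ _ => occWeight_pos _ _)
    ⟨∅, Finset.empty_mem_powerset _⟩

theorem prod_children_piecewise_edgeFactor (hmsg : ∀ y ∉ B, msg y = id) (x : V) (t : ℝ) :
    ∏ y ∈ children G o x, B.piecewise (edgeFactor S) msg y t =
      t ^ #{y ∈ children G o x | y ∈ B → y ∈ S} *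
        (1 - t) ^ (#(children G o x) - #{y ∈ children G o x | y ∈ B → y ∈ S}) := by
  have factor_eq (y : V) : B.piecewise (edgeFactor S) msg y t =
      if y ∈ B → y ∈ S then t else 1 - t := by
    by_cases hy : y ∈ B <;> simp [hy, edgeFactor, hmsg]
  simp only [factor_eq]
  rw [Finset.prod_ite, Finset.prod_const, Finset.prod_const,
    ← Finset.card_filter_add_card_filter_not (s := children G o x) (fun y => y ∈ B → y ∈ S),
    Nat.add_sub_cancel_left]

theorem vertexWeight_edgeFactor (hG : G.IsTree) (hmsg : ∀ y ∉ B, msg y = id) {x : V} (hx : x ≠ o) :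
    vertexWeight G o (edgeFactor S) (B.piecewise (edgeFactor S) msg) x =
      occWeight (G.degree x) (count G o B S x) := by
  rw [vertexWeight, occWeight, ← card_children_add_one hG hx, count]
  congr 1
  funext t
  rw [prod_children_piecewise_edgeFactor hmsg, edgeFactor]
  have := Finset.card_filter_le (children G o x) fun y => y ∈ B → y ∈ S
  split_ifs
  · rw [pow_add, pow_one, mul_assoc, add_comm 1, Nat.add_sub_add_right]
  · rw [zero_add, Nat.sub_add_comm this, pow_succ]
    ring

theorem regionWeight_edgeFactor (hG : G.IsTree) (ho : o ∈ B) (hS : o ∉ S)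
    (hmsg : ∀ y ∉ B, msg y = id) (φ : ℝ → ℝ) :
    regionWeight G o B φ (edgeFactor S) msg =
      (∫ t in (0 : ℝ)..1,
          φ t * (t ^ count G o B S o * (1 - t) ^ (G.degree o - count G o B S o))) *
        ∏ x ∈ B.erase o, occWeight (G.degree x) (count G o B S x) := by
  rw [regionWeight, ← Finset.mul_prod_erase _ _ ho]
  congr 1
  · rw [vertexWeight, Function.update_self, ← card_children_root, count, if_neg hS, zero_add]
    simp only [prod_children_piecewise_edgeFactor hmsg]
  · refine Finset.prod_congr rfl fun x hx => ?_
    rw [← vertexWeight_edgeFactor hG hmsg (Finset.ne_of_mem_erase hx)]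
    exact vertexWeight_congr (Function.update_of_ne (Finset.ne_of_mem_erase hx) _ _)
      fun _ _ => rfl

theorem partitionFunction_one (hG : G.IsTree) (ho : o ∈ B) (hmsg : ∀ y ∉ B, msg y = id) :
    partitionFunction G o B 1 msg = ∑ S ∈ (B.erase o).powerset, markingWeight G o B S := by
  refine Finset.sum_congr rfl fun S hS => ?_
  have hoS : o ∉ S := fun h => Finset.notMem_erase o B (Finset.mem_powerset.1 hS h)
  rw [regionWeight_edgeFactor hG ho hoS hmsg, markingWeight, ← Finset.mul_prod_erase _ _ ho]
  simp only [Pi.one_apply, one_mul, occWeight]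

theorem partitionFunction_two_mul_sub_one (hG : G.IsTree) (ho : o ∈ B)
    (hmsg : ∀ y ∉ B, msg y = id) :
    partitionFunction G o B (fun t => 2 * t - 1) msg =
      2 / ((G.degree o : ℝ) + 2) * ∑ S ∈ (B.erase o).powerset,
        markingWeight G o B S * ((count G o B S o : ℝ) - (G.degree o : ℝ) / 2) := by
  rw [partitionFunction, Finset.mul_sum]
  refine Finset.sum_congr rfl fun S hS => ?_
  have hoS : o ∉ S := fun h => Finset.notMem_erase o B (Finset.mem_powerset.1 hS h)
  rw [regionWeight_edgeFactor hG ho hoS hmsg, markingWeight, ← Finset.mul_prod_erase _ _ ho,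
    integral_two_mul_sub_one_mul_pow (count_le_degree hG hoS o)]
  ring

theorem rootMagnetization_eq (hG : G.IsTree) (hB : IsRootedSubtree G o B)
    (hcont : ∀ y, Continuous (msg y)) (hmsg : ∀ y ∉ B, msg y = id)
    (hrec : ∀ x ∈ B.erase o, msg x = transfer fun s => ∏ z ∈ children G o x, msg z s) :
    rootMagnetization G o B = ((G.degree o : ℝ) + 2) / 2 *
      ((∫ t in (0 : ℝ)..1, (2 * t - 1) * ∏ y ∈ children G o o, msg y t) /
        ∫ t in (0 : ℝ)..1, ∏ y ∈ children G o o, msg y t) := by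
  have numerator := partitionFunction_eq_integral (φ := fun t => 2 * t - 1) hG (by fun_prop)
    hcont hB hrec
  have denominator := partitionFunction_eq_integral (φ := 1) hG continuous_one hcont hB hrec
  simp only [Pi.one_apply, one_mul] at denominator
  rw [← numerator, ← denominator, partitionFunction_one hG hB.root_mem hmsg,
    partitionFunction_two_mul_sub_one hG hB.root_mem hmsg, rootMagnetization,
    mul_div_assoc, ← mul_assoc, ← inv_div _ (2 : ℝ), mul_inv_cancel₀ (by positivity), one_mul]

theorem rootMagnetization_ball (hG : G.IsTree) (n : ℕ) :
    rootMagnetization G o (ball G o n) = ((G.degree o : ℝ) + 2) / 2 *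
      ((∫ t in (0 : ℝ)..1, (2 * t - 1) * ∏ y ∈ children G o o, message G o n y t) /
        ∫ t in (0 : ℝ)..1, ∏ y ∈ children G o o, message G o n y t) := by
  have at_children {k : ℕ} {x : V} (hx : G.dist o x + k = n) (s : ℝ) :
      ∏ y ∈ children G o x, message G o (n + 1 - G.dist o y) y s =
        ∏ y ∈ children G o x, message G o k y s := by
    refine Finset.prod_congr rfl fun y hy => ?_
    rw [(mem_children.1 hy).2, Nat.add_sub_add_right, ← hx, Nat.add_sub_cancel_left]
  rw [rootMagnetization_eq (msg := fun y => message G o (n + 1 - G.dist o y) y) hG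
    (isRootedSubtree_ball hG.connected n) (fun y => continuous_message G o _ y)]
  · have dist_root : G.dist o o + n = n := by simp
    simp only [at_children dist_root]
  · intro y hy
    rw [mem_ball G hG.connected, not_le] at hy
    rw [Nat.sub_eq_zero_of_le hy, message]
  · intro x hx
    obtain ⟨k, hk⟩ := Nat.exists_eq_add_of_le
      ((mem_ball G hG.connected o x n).1 (Finset.mem_of_mem_erase hx))
    simp only [at_children hk.symm]
    rw [hk, add_assoc, Nat.add_sub_cancel_left, message]

theorem exists_forall_le_rootMagnetization (hG : G.IsTree) (hne : ∀ x, (children G o x).Nonempty)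
    {C μ : ℝ} (hC : 0 < C) (hμ : 1 < μ) (hgrowth : HasGrowth G o C μ) :
    ∃ c > 0, ∀ n, c ≤ rootMagnetization G o (ball G o n) := by
  have hroot : IsDescending G o (fun _ => o) 0 := ⟨rfl, fun k hk => absurd hk k.not_lt_zero⟩
  have hb : 0 < slopeBound G o C μ (fun _ => o) 0 := pos_of_mul_pos_left
    (three_pos.trans_le (three_le_slopeBound hC hμ hgrowth hroot))
    (sub_nonneg.2 (inv_le_one_of_one_le₀ hμ.le))
  set L := 3 + 3 * slopeBound G o C μ (fun _ => o) 0 / #(children G o o)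
  have hL0 : 0 < L := by positivity
  refine ⟨((G.degree o : ℝ) + 2) / 2 * L⁻¹, by positivity, fun n => ?_⟩
  obtain ⟨hpos, hle, hle_mul⟩ := IsTilted.integral_prod_le (hne o) fun y hy =>
    isTilted_message hne hC hμ hgrowth n hroot hy
  rw [rootMagnetization_ball hG]
  gcongr
  rwa [inv_eq_one_div, div_le_div_iff₀ hL0 (hpos.trans_le hle), one_mul, mul_comm]

end Magnetization

/-! ### The spin at the root -/

section RootSpin

variable {V : Type*} [DecidableEq V]

theorem extend_onSite {d : V → ℕ} {Λ Λ' : Finset V} (h : Λ ⊆ Λ') (x : Λ)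
    (M : Matrix (Fin (d x + 1)) (Fin (d x + 1)) ℂ) :
    extend h (onSite x M : Obs d Λ) = onSite (⟨x, h x.2⟩ : Λ') M := by
  ext σ τ
  simp only [extend, onSite, Matrix.of_apply, ← ite_and]
  congr 1
  rw [eq_iff_iff]
  refine ⟨fun ⟨outside, inside⟩ y hy => ?_, fun hy => ⟨fun y hyΛ => hy y ?_, fun y hyx => hy _ ?_⟩⟩
  · by_cases hyΛ : (y : V) ∈ Λ
    · exact inside ⟨y, hyΛ⟩ fun hyx => hy (Subtype.ext (Subtype.ext_iff.1 hyx :))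
    · exact outside y hyΛ
  · rintro rfl
    exact hyΛ x.2
  · exact fun h => hyx (Subtype.ext (Subtype.ext_iff.1 h :))

theorem onSite_diagonal {d : V → ℕ} {Λ : Finset V} (x : Λ) (v : Fin (d x + 1) → ℂ) :
    (onSite x (Matrix.diagonal v) : Obs d Λ) = Matrix.diagonal fun σ => v (σ x) := by
  ext σ τ
  simp only [onSite, Matrix.of_apply, Matrix.diagonal_apply, ← ite_and]
  congr 1
  rw [eq_iff_iff]
  refine ⟨fun ⟨others, here⟩ => funext fun y => ?_, ?_⟩
  · rcases eq_or_ne y x with rfl | hy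
    exacts [here, others y hy]
  · rintro rfl
    exact ⟨fun _ _ => rfl, rfl⟩

theorem expectation_pureState_diagonal_onSite {d : V → ℕ} {Λ Λ' : Finset V} (h : Λ ⊆ Λ')
    (x : Λ) (v : Fin (d x + 1) → ℂ) (ψ : Conf d Λ' → ℂ) :
    expectation (pureState ψ) Λ (onSite x (Matrix.diagonal v)) =
      (∑ σ, ψ σ * star (ψ σ) * v (σ ⟨x, h x.2⟩)) / ∑ σ, ψ σ * star (ψ σ) := by
  rw [expectation, dif_pos h, extend_onSite, onSite_diagonal, pureState, Matrix.smul_mul,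
    Matrix.trace_smul, smul_eq_mul, inv_mul_eq_div]
  simp [Matrix.trace, Matrix.vecMulVec_apply, dotProduct]

variable (G : SimpleGraph V) [G.LocallyFinite] (o : V)

/-- The third component of the spin at the root. -/
def rootSpin : Obs (fun v => G.degree v) {o} :=
  onSite ⟨o, Finset.mem_singleton_self o⟩ (spinZ (G.degree o))

variable {G o} {B : Finset V}

theorem sum_bondState_mul_star (hG : G.IsTree) (B : Finset V) (c : V → Bool) :
    ∑ σ, bondState G o B c σ * star (bondState G o B c σ) =
      ((∑ S ∈ (B.erase o).powerset, markingWeight G o B S : ℝ) : ℂ) := by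
  have := sum_bondState (o := o) hG B c fun _ => 1
  simpa only [mul_one, Complex.ofReal_sum] using this

theorem bondState_ne_zero (hG : G.IsTree) (B : Finset V) (c : V → Bool) :
    bondState G o B c ≠ 0 := fun h => by
  have := sum_bondState_mul_star (o := o) hG B c
  simp only [h, Pi.zero_apply, zero_mul, Finset.sum_const_zero] at this
  exact sum_markingWeight_pos.ne (Complex.ofReal_eq_zero.1 this.symm).symm

theorem expectation_rootSpin (hG : G.IsTree) (ho : o ∈ B) (c : V → Bool) :
    expectation (pureState (bondState G o B c)) {o} (rootSpin G o) =
      (((if c o then 1 else -1) * rootMagnetization G o B : ℝ) : ℂ) := by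
  have spin_eq (S : Finset V) (hS : S ∈ (B.erase o).powerset) :
      ((bosonConf (fun v => G.degree v) B c (count G o B S) ⟨o, ho⟩ : ℕ) : ℂ)
          - (G.degree o : ℂ) / 2 =
        (((if c o then 1 else -1) * ((count G o B S o : ℝ) - (G.degree o : ℝ) / 2) : ℝ) : ℂ) := by
    have hoS : o ∉ S := fun h => Finset.notMem_erase o B (Finset.mem_powerset.1 hS h)
    have hle := count_le_degree (B := B) hG hoS o
    cases hc : c o
    · rw [bosonConf_apply_of_false hc hle, Nat.cast_sub hle]
      push_cast
      ring
    · rw [bosonConf_apply_of_true hc hle]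
      simp
  rw [rootSpin, spinZ, expectation_pureState_diagonal_onSite (Finset.singleton_subset_iff.2 ho),
    sum_bondState_mul_star hG, sum_bondState hG B c fun σ =>
      ((σ ⟨o, ho⟩ : ℕ) : ℂ) - (G.degree o : ℂ) / 2,
    Finset.sum_congr rfl fun S hS => by rw [spin_eq S hS, ← Complex.ofReal_mul, mul_left_comm],
    ← Complex.ofReal_sum, ← Complex.ofReal_div, ← Finset.mul_sum, mul_div_assoc,
    ← rootMagnetization]

theorem exists_infiniteVolumeGroundState_rootSpin [DecidableRel G.Adj] (hG : G.IsTree)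
    {c : V → Bool} (hc : ∀ x y, G.Adj x y → c x = !c y) :
    ∃ ω ∈ infiniteVolumeGroundStates G o,
      Tendsto (fun n => (if c o then 1 else -1) * rootMagnetization G o (ball G o n))
        (hyperfilter ℕ : Filter ℕ) (𝓝 (ω {o} (rootSpin G o)).re) := by
  obtain ⟨ω, hω, hlim⟩ := exists_infiniteVolumeGroundState_tendsto hG.connected o
    (fun n => pureState (bondState G o (ball G o n) c)) fun n =>
      isGroundState_pureState (bondState_mem_bondedSpace hG _ hc) (bondState_ne_zero hG _ c)
  refine ⟨ω, hω, ((Complex.continuous_re.tendsto _).comp (hlim {o} (rootSpin G o))).congr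
    fun n => ?_⟩
  rw [Function.comp_apply, expectation_rootSpin hG (isRootedSubtree_ball hG.connected n).root_mem,
    Complex.ofReal_re]

end RootSpin

theorem decide_odd_dist_of_adj {V : Type*} {G : SimpleGraph V} (hG : G.IsTree) (o : V) {x y : V}
    (hxy : G.Adj x y) :
    decide (Odd (G.dist o x)) = !decide (Odd (G.dist o y)) := by
  rcases hG.dist_eq_dist_add_one_of_adj o hxy with h | h <;>
    simp [h, Nat.odd_add_one, -Nat.not_odd_iff_even]

end AKLT

end

theorem mainTheorem3 {V : Type*} [DecidableEq V] [Infinite V] (G : SimpleGraph V)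
    [G.LocallyFinite] [DecidableRel G.Adj] (hG : G.IsTree) (o : V)
    (hleaf : ∀ v : V, G.degree v ≠ 1) (μ C : ℝ) (hμ : 1 < μ) (hC : 0 < C)
    (hpath : ∀ p : ℕ → V, p 0 = o → (∀ k, G.Adj (p k) (p (k + 1))) →
      (∀ k, G.dist o (p k) = k) →
      ∀ n : ℕ, C * μ ^ n ≤ ∏ k ∈ Finset.Icc 1 n, ((G.degree (p k) : ℝ) - 1) / 3) :
    ∃ ω₁ ∈ AKLT.infiniteVolumeGroundStates G o, ∃ ω₂ ∈ AKLT.infiniteVolumeGroundStates G o,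
      ω₁ ≠ ω₂ := by
  have hne := AKLT.children_nonempty (o := o) hG hleaf
  obtain ⟨c, hc, hmag⟩ := AKLT.exists_forall_le_rootMagnetization hG hne hC hμ
    (AKLT.hasGrowth_of_forall_ray hG hne hpath)
  obtain ⟨ω₁, hω₁, hlim₁⟩ := AKLT.exists_infiniteVolumeGroundState_rootSpin (o := o) hG
    (c := fun x => !decide (Odd (G.dist o x)))
    fun x y hxy => congrArg (!·) (AKLT.decide_odd_dist_of_adj hG o hxy)
  obtain ⟨ω₂, hω₂, hlim₂⟩ := AKLT.exists_infiniteVolumeGroundState_rootSpin (o := o) hG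
    (c := fun x => decide (Odd (G.dist o x))) fun x y => AKLT.decide_odd_dist_of_adj hG o
  simp only [SimpleGraph.dist_self, Nat.not_odd_zero, decide_false, Bool.not_false,
    Bool.false_eq_true, if_true, if_false, one_mul, neg_one_mul] at hlim₁ hlim₂
  refine ⟨ω₁, hω₁, ω₂, hω₂, ?_⟩
  rintro rfl
  have up : c ≤ (ω₁ {o} (AKLT.rootSpin G o)).re :=
    ge_of_tendsto hlim₁ (Eventually.of_forall hmag)
  have down : (ω₁ {o} (AKLT.rootSpin G o)).re ≤ -c :=
    le_of_tendsto hlim₂ (Eventually.of_forall fun n => neg_le_neg (hmag n))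
  linarith
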